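/- Work in the ring $\mathbb{Q}[[q]]$ of formal power series, where $\frac1{1-q^n}=\sum_{d\ge 0}q^{nd}$ and all the sums below are locally finite. Let $$Z(2)=\sum_{n>0}\frac{q^n}{(1-q^n)^2},\qquad Z(4)=\sum_{n>0}\frac{q^{2n}}{(1-q^n)^4},\qquad Z(6)=\sum_{n>0}\frac{q^{3n}}{(1-q^n)^6},$$ and define $$h_{1,1}^{(0)}=\sum_{i,j>0}\frac{ij(i+j)q^{i+j}}{(1-q^i)(1-q^j)(1-q^{i+j})},$$ $$h_{1,1}^{(2)}=-\sum_{i,j>0}\frac{j(i+j)(q^{i+j}+q^{2i+j})}{(1-q^i)^2(1-q^j)(1-q^{i+j})}-\frac12\sum_{i,j>0}\frac{ij(q^{i+j}+q^{2i+2j})}{(1-q^i)(1-q^j)(1-q^{i+j})^2},$$ $$\begin{aligned}h_{1,1}^{(4)}={}&\frac14\sum_{\substack{i,j,k,\ell>0\\ i+j=k+\ell}}\frac{(i+j)q^{i+j}(1+q^{i+j})}{(1-q^i)(1-q^j)(1-q^k)(1-q^\ell)(1-q^{i+j})}\\&-\sum_{i,j,k>0}\frac{(i+j)q^{i+j+k}(1+q^{i+j})}{(1-q^i)(1-q^j)(1-q^k)(1-q^{i+j})(1-q^{i+j+k})}\\&+\sum_{i,j,k>0}\frac{kq^{i+j+k}(1+q^k)}{(1-q^i)(1-q^j)(1-q^k)(1-q^{i+k})(1-q^{j+k})}.\end{aligned}$$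 Then $$h_{1,1}^{(0)}=Z(2)^2+Z(4)-\tfrac83Z(2)^3+4Z(2)Z(4)+\tfrac{14}3Z(6),$$ $$h_{1,1}^{(2)}=-\Bigl(\tfrac54Z(2)^2+\tfrac54Z(4)-\tfrac{10}3Z(2)^3+5Z(2)Z(4)+\tfrac{35}6Z(6)\Bigr),$$ $$h_{1,1}^{(4)}=\tfrac14Z(2)^2+\tfrac14Z(4)-\tfrac23Z(2)^3+Z(2)Z(4)+\tfrac76Z(6).$$ -/

import Mathlib

namespace QSeries

open PowerSeries in
/-- The formal sum of a family of power series in `ℚ⟦q⟧`, taken coefficient by coefficient.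
It is the sum in `ℚ⟦q⟧` whenever the family is locally finite (`IsLocallyFinite` below). -/
noncomputable def qSum {ι : Type} (f : ι → ℚ⟦X⟧) : ℚ⟦X⟧ :=
  PowerSeries.mk fun n => ∑ᶠ i, coeff n (f i)

open PowerSeries in
/-- Each power of `q` occurs in only finitely many members of the family. -/
def IsLocallyFinite {ι : Type} (f : ι → ℚ⟦X⟧) : Prop :=
  ∀ n : ℕ, (Function.support fun i => coeff n (f i)).Finite

open PowerSeries in
/-- The variable `q`. -/
noncomputable def q : ℚ⟦X⟧ := X

open PowerSeries in
/-- The polynomials `Q_s(t)`: `t ^ (s / 2)` for even `s`, `t ^ ((s - 1) / 2) * (t + 1)` for odd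
`s`. -/
noncomputable def okounkovQ (s : ℕ) (t : ℚ⟦X⟧) : ℚ⟦X⟧ :=
  if Even s then t ^ (s / 2) else t ^ ((s - 1) / 2) * (t + 1)

open PowerSeries in
/-- The summand `Q_s(q^n) / (1 - q^n)^s`. Since `n` is positive, `1 - q^n` is a unit of `ℚ⟦q⟧`. -/
noncomputable def okounkovTerm (s : ℕ) (n : ℕ+) : ℚ⟦X⟧ :=
  okounkovQ s (q ^ (n : ℕ)) * ((1 - q ^ (n : ℕ)) ^ s)⁻¹

open PowerSeries in
/-- The Okounkov series `Z(s) = ∑_{n > 0} Q_s(q^n) / (1 - q^n)^s` of length one, `s ≥ 2`. -/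
noncomputable def okounkovZ (s : ℕ) : ℚ⟦X⟧ := qSum (okounkovTerm s)

open PowerSeries in
/-- `i j (i+j) q^{i+j} / ((1-q^i) (1-q^j) (1-q^{i+j}))`. -/
noncomputable def h0Term : ℕ+ × ℕ+ → ℚ⟦X⟧
  | (i, j) =>
    ((i * j * (i + j) : ℕ) : ℚ⟦X⟧) * q ^ (i + j : ℕ) *
      ((1 - q ^ (i : ℕ)) * (1 - q ^ (j : ℕ)) * (1 - q ^ (i + j : ℕ)))⁻¹

open PowerSeries in
/-- `j (i+j) (q^{i+j} + q^{2i+j}) / ((1-q^i)^2 (1-q^j) (1-q^{i+j}))`. -/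
noncomputable def h2TermA : ℕ+ × ℕ+ → ℚ⟦X⟧
  | (i, j) =>
    ((j * (i + j) : ℕ) : ℚ⟦X⟧) * (q ^ (i + j : ℕ) + q ^ (2 * i + j : ℕ)) *
      ((1 - q ^ (i : ℕ)) ^ 2 * (1 - q ^ (j : ℕ)) * (1 - q ^ (i + j : ℕ)))⁻¹

open PowerSeries in
/-- `i j (q^{i+j} + q^{2i+2j}) / ((1-q^i) (1-q^j) (1-q^{i+j})^2)`. -/
noncomputable def h2TermB : ℕ+ × ℕ+ → ℚ⟦X⟧
  | (i, j) =>
    ((i * j : ℕ) : ℚ⟦X⟧) * (q ^ (i + j : ℕ) + q ^ (2 * i + 2 * j : ℕ)) *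
      ((1 - q ^ (i : ℕ)) * (1 - q ^ (j : ℕ)) * (1 - q ^ (i + j : ℕ)) ^ 2)⁻¹

/-- Quadruples `(i, j, k, l)` of positive integers with `i + j = k + l`. -/
def QuadIndex : Type :=
  {p : ℕ+ × ℕ+ × ℕ+ × ℕ+ // p.1 + p.2.1 = p.2.2.1 + p.2.2.2}

open PowerSeries in
/-- `(i+j) q^{i+j} (1+q^{i+j}) / ((1-q^i) (1-q^j) (1-q^k) (1-q^l) (1-q^{i+j}))`. -/
noncomputable def h4TermA : QuadIndex → ℚ⟦X⟧
  | ⟨(i, j, k, l), _⟩ =>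
    ((i + j : ℕ) : ℚ⟦X⟧) * q ^ (i + j : ℕ) * (1 + q ^ (i + j : ℕ)) *
      ((1 - q ^ (i : ℕ)) * (1 - q ^ (j : ℕ)) * (1 - q ^ (k : ℕ)) * (1 - q ^ (l : ℕ)) *
        (1 - q ^ (i + j : ℕ)))⁻¹

open PowerSeries in
/-- `(i+j) q^{i+j+k} (1+q^{i+j}) / ((1-q^i) (1-q^j) (1-q^k) (1-q^{i+j}) (1-q^{i+j+k}))`. -/
noncomputable def h4TermB : ℕ+ × ℕ+ × ℕ+ → ℚ⟦X⟧
  | (i, j, k) =>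
    ((i + j : ℕ) : ℚ⟦X⟧) * q ^ (i + j + k : ℕ) * (1 + q ^ (i + j : ℕ)) *
      ((1 - q ^ (i : ℕ)) * (1 - q ^ (j : ℕ)) * (1 - q ^ (k : ℕ)) * (1 - q ^ (i + j : ℕ)) *
        (1 - q ^ (i + j + k : ℕ)))⁻¹

open PowerSeries in
/-- `k q^{i+j+k} (1+q^k) / ((1-q^i) (1-q^j) (1-q^k) (1-q^{i+k}) (1-q^{j+k}))`. -/
noncomputable def h4TermC : ℕ+ × ℕ+ × ℕ+ → ℚ⟦X⟧
  | (i, j, k) =>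
    ((k : ℕ) : ℚ⟦X⟧) * q ^ (i + j + k : ℕ) * (1 + q ^ (k : ℕ)) *
      ((1 - q ^ (i : ℕ)) * (1 - q ^ (j : ℕ)) * (1 - q ^ (k : ℕ)) * (1 - q ^ (i + k : ℕ)) *
        (1 - q ^ (j + k : ℕ)))⁻¹

open PowerSeries in
/-- The series `h_{1,1}^{(0)}`. -/
noncomputable def h11_0 : ℚ⟦X⟧ := qSum h0Term

open PowerSeries in
/-- The series `h_{1,1}^{(2)}`. -/
noncomputable def h11_2 : ℚ⟦X⟧ := -qSum h2TermA - (1 / 2 : ℚ) • qSum h2TermB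

open PowerSeries in
/-- The series `h_{1,1}^{(4)}`. -/
noncomputable def h11_4 : ℚ⟦X⟧ :=
  (1 / 4 : ℚ) • qSum h4TermA - qSum h4TermB + qSum h4TermC

/- All the sums above are locally finite, so that `qSum` is the sum of the family in each case. -/

open PowerSeries in
theorem IsLocallyFinite.of_dvd {ι : Type} {f : ι → ℚ⟦X⟧} (e : ι → ℕ)
    (hd : ∀ i, q ^ e i ∣ f i) (he : ∀ n, {i | e i ≤ n}.Finite) : IsLocallyFinite f := by
  intro n
  refine (he n).subset fun i hi => ?_
  by_contra h
  exact hi (PowerSeries.X_pow_dvd_iff.1 (hd i) n (not_le.1 h))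

theorem finite_pairs (n : ℕ) : {p : ℕ+ × ℕ+ | (p.1 + p.2 : ℕ) ≤ n}.Finite := by
  refine (Set.finite_Iic ((n.succPNat, n.succPNat) : ℕ+ × ℕ+)).subset ?_
  rintro ⟨i, j⟩ (h : (i + j : ℕ) ≤ n)
  refine Set.mem_Iic.2 ⟨?_, ?_⟩ <;> rw [← PNat.coe_le_coe] <;> simp <;> omega

theorem finite_triples (n : ℕ) :
    {p : ℕ+ × ℕ+ × ℕ+ | (p.1 + p.2.1 + p.2.2 : ℕ) ≤ n}.Finite := by
  refine (Set.finite_Iic ((n.succPNat, n.succPNat, n.succPNat) : ℕ+ × ℕ+ × ℕ+)).subset ?_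
  rintro ⟨i, j, k⟩ (h : (i + j + k : ℕ) ≤ n)
  refine Set.mem_Iic.2 ⟨?_, ?_, ?_⟩ <;> rw [← PNat.coe_le_coe] <;> simp <;> omega

theorem finite_quads (n : ℕ) :
    {p : QuadIndex | (p.1.1 + p.1.2.1 : ℕ) ≤ n}.Finite := by
  have h4 := (Set.finite_Iic ((n.succPNat, n.succPNat, n.succPNat, n.succPNat) :
    ℕ+ × ℕ+ × ℕ+ × ℕ+))
  refine (h4.preimage Subtype.val_injective.injOn).subset ?_
  rintro ⟨⟨i, j, k, l⟩, hp⟩ (h : (i + j : ℕ) ≤ n)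
  have hp' : (i + j : ℕ) = k + l := by
    have := congrArg PNat.val hp
    simpa using this
  suffices H : (i, j, k, l) ≤ (n.succPNat, n.succPNat, n.succPNat, n.succPNat) from H
  refine ⟨?_, ?_, ?_, ?_⟩ <;> rw [← PNat.coe_le_coe] <;> simp <;> omega

theorem okounkovTerm_isLocallyFinite {s : ℕ} (hs : 2 ≤ s) :
    IsLocallyFinite (okounkovTerm s) := by
  refine .of_dvd (fun n => (n : ℕ)) (fun n => ?_) fun n => ?_
  · refine Dvd.dvd.mul_right ?_ _
    unfold okounkovQ
    split_ifs with h
    · exact dvd_pow_self _ (by omega)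
    · refine Dvd.dvd.mul_right (dvd_pow_self _ ?_) _
      have : s ≠ 2 := by rintro rfl; exact h even_two
      omega
  · refine (Set.finite_Iic n.succPNat).subset fun i (hi : (i : ℕ) ≤ n) => ?_
    rw [Set.mem_Iic, ← PNat.coe_le_coe]
    simp
    omega

theorem h0Term_isLocallyFinite : IsLocallyFinite h0Term := by
  refine .of_dvd (fun p => (p.1 + p.2 : ℕ)) ?_ finite_pairs
  rintro ⟨i, j⟩
  unfold h0Term
  exact (dvd_mul_left _ _).mul_right _

theorem h2TermA_isLocallyFinite : IsLocallyFinite h2TermA := by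
  refine .of_dvd (fun p => (p.1 + p.2 : ℕ)) ?_ finite_pairs
  rintro ⟨i, j⟩
  unfold h2TermA
  exact ((dvd_add dvd_rfl (pow_dvd_pow _ (by dsimp only; omega))).mul_left _).mul_right _

theorem h2TermB_isLocallyFinite : IsLocallyFinite h2TermB := by
  refine .of_dvd (fun p => (p.1 + p.2 : ℕ)) ?_ finite_pairs
  rintro ⟨i, j⟩
  unfold h2TermB
  exact ((dvd_add dvd_rfl (pow_dvd_pow _ (by dsimp only; omega))).mul_left _).mul_right _

theorem h4TermA_isLocallyFinite : IsLocallyFinite h4TermA := by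
  refine .of_dvd (fun p => (p.1.1 + p.1.2.1 : ℕ)) ?_ finite_quads
  rintro ⟨⟨i, j, k, l⟩, h⟩
  unfold h4TermA
  exact ((dvd_mul_left _ _).mul_right _).mul_right _

theorem h4TermB_isLocallyFinite : IsLocallyFinite h4TermB := by
  refine .of_dvd (fun p => (p.1 + p.2.1 + p.2.2 : ℕ)) ?_ finite_triples
  rintro ⟨i, j, k⟩
  unfold h4TermB
  exact ((dvd_mul_left _ _).mul_right _).mul_right _

theorem h4TermC_isLocallyFinite : IsLocallyFinite h4TermC := by
  refine .of_dvd (fun p => (p.1 + p.2.1 + p.2.2 : ℕ)) ?_ finite_triples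
  rintro ⟨i, j, k⟩
  unfold h4TermC
  exact ((dvd_mul_left _ _).mul_right _).mul_right _

end QSeries

open QSeries

/-!
All three series are evaluated as divisor sums: with
`D = ∑_{N > 0} (N σ₃(N) - N² σ₁(N)) q ^ N` one has `h₀ = D / 3`, `h₂ = -5 D / 12` and
`h₄ = D / 12`, and the combination of `Z(2)`, `Z(4)`, `Z(6)` equal to `h₀` is also `D / 3`
(`okounkov_combination`).

The tool for the first two series and for the products of the `Z(s)` is a form of Liouville's
method. Expanding everything in powers of `q` gives sums over solutions of `i a + j b = N` with
polynomial coefficients. Transposing `(i, a)` preserves such a sum (`pairSum_transpose`). The part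
`j > i`, with `j = i + k`, is preserved by `(i, k, a, b) ↦ (b, a, k, i)` (`coneSum_euclid`), and the
whole sum is the part `j > i`, plus the part `j < i`, which is again of the first kind, plus the
diagonal (`pairSum_eq_coneSum`). Hence a polynomial identity between coefficients suffices to
reduce a sum to its diagonal (`coneSum_add_diagonalSum`); the polynomials given to this lemma
below are solutions of the resulting linear system. It gives the classical convolutions `σ * σ`,
`σ * σ₃` and `σ * N σ`, which also yield `Z(2)³`.

The partial fraction identity `geom_mul_geom`, i.e.
`1 / ((1 - x) (1 - y)) = (1 / (1 - x) + 1 / (1 - y) - 1) / (1 - x y)`,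
turns `h₀` and `h₂` into sums over `j > i` and a diagonal. In `h₄`, let `n` be the index that
carries the linear factor. The remaining indices separate, and the three sums become the three
terms of `∑_n n q ^ n (1 + q ^ n) / (1 - q ^ n) (G n / 2 - T n)²`, where
`G n = ∑_{i < n} 1 / ((1 - q ^ i) (1 - q ^ (n - i)))` and
`T n = ∑_{k > 0} q ^ k / ((1 - q ^ k) (1 - q ^ (n + k)))`.
By partial fractions and telescoping both are expressed through `∑_{i < n} q ^ i / (1 - q ^ i)`,
which cancels in the difference, so that `h₄` is a divisor sum (`four_smul_h11_4`).
-/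

namespace QSeries

open PowerSeries

/-! ### Calculus of locally finite sums -/

section LocallyFinite

variable {ι κ : Type}

theorem coeff_qSum (f : ι → ℚ⟦X⟧) (n : ℕ) : coeff n (qSum f) = ∑ᶠ i, coeff n (f i) :=
  coeff_mk _ _

theorem IsLocallyFinite.add {f g : ι → ℚ⟦X⟧} (hf : IsLocallyFinite f) (hg : IsLocallyFinite g) :
    IsLocallyFinite fun i => f i + g i := by
  intro n
  refine ((hf n).union (hg n)).subset fun i hi => ?_
  by_contra h
  simp only [Set.mem_union, Function.mem_support, not_or, not_not] at h
  exact hi (by simp [h.1, h.2])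

theorem IsLocallyFinite.mul_left {f : ι → ℚ⟦X⟧} (hf : IsLocallyFinite f) (a : ι → ℚ⟦X⟧) :
    IsLocallyFinite fun i => a i * f i := by
  intro n
  refine ((Set.finite_Iic n).biUnion fun b _ => hf b).subset fun i hi => ?_
  by_contra h
  simp only [Set.mem_iUnion, Function.mem_support, not_exists, not_not, Set.mem_Iic] at h
  refine hi ?_
  dsimp only
  rw [coeff_mul]
  refine Finset.sum_eq_zero fun p hp => ?_
  have := Finset.HasAntidiagonal.mem_antidiagonal.1 hp
  rw [h p.2 (by omega), mul_zero]

theorem IsLocallyFinite.comp_injective {f : ι → ℚ⟦X⟧} (hf : IsLocallyFinite f) {φ : κ → ι}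
    (hφ : Function.Injective φ) : IsLocallyFinite fun k => f (φ k) :=
  fun n => (hf n).preimage hφ.injOn

theorem IsLocallyFinite.mul {f : ι → ℚ⟦X⟧} {g : κ → ℚ⟦X⟧} (hf : IsLocallyFinite f)
    (hg : IsLocallyFinite g) : IsLocallyFinite fun p : ι × κ => f p.1 * g p.2 := by
  intro n
  refine ((Set.finite_Iic n).biUnion fun a _ => (Set.finite_Iic n).biUnion fun b _ =>
    (hf a).prod (hg b)).subset fun i hi => ?_
  by_contra h
  refine hi ?_
  dsimp only
  rw [coeff_mul]
  refine Finset.sum_eq_zero fun p hp => ?_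
  by_contra hne
  refine h ?_
  have := Finset.HasAntidiagonal.mem_antidiagonal.1 hp
  simp only [Set.mem_iUnion]
  exact ⟨p.1, Set.mem_Iic.2 (by omega), p.2, Set.mem_Iic.2 (by omega),
    left_ne_zero_of_mul hne, right_ne_zero_of_mul hne⟩

theorem IsLocallyFinite.qSum_snd {f : ι × κ → ℚ⟦X⟧} (hf : IsLocallyFinite f) :
    IsLocallyFinite fun i => qSum fun k => f (i, k) := by
  intro n
  refine ((hf n).image Prod.fst).subset fun i hi => ?_
  by_contra h
  refine hi ?_
  dsimp only
  rw [coeff_qSum]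
  refine finsum_eq_zero_of_forall_eq_zero fun k => ?_
  by_contra hk
  exact h ⟨(i, k), hk, rfl⟩

theorem qSum_add {f g : ι → ℚ⟦X⟧} (hf : IsLocallyFinite f) (hg : IsLocallyFinite g) :
    qSum (fun i => f i + g i) = qSum f + qSum g := by
  ext n
  simp only [coeff_qSum, map_add]
  exact finsum_add_distrib (hf n) (hg n)

theorem qSum_smul (c : ℚ) (f : ι → ℚ⟦X⟧) : qSum (fun i => c • f i) = c • qSum f := by
  ext n
  simp only [coeff_qSum, map_smul]
  exact (smul_finsum c _).symm

theorem qSum_mul_left (a : ℚ⟦X⟧) {f : ι → ℚ⟦X⟧} (hf : IsLocallyFinite f) :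
    qSum (fun i => a * f i) = a * qSum f := by
  ext n
  simp only [coeff_qSum, coeff_mul]
  rw [finsum_sum_comm]
  · exact Finset.sum_congr rfl fun p _ => (mul_finsum _ _).symm
  · exact fun p _ => (hf p.2).subset fun i hi => right_ne_zero_of_mul hi

theorem qSum_comp_equiv (e : κ ≃ ι) (f : ι → ℚ⟦X⟧) : qSum (fun k => f (e k)) = qSum f := by
  ext n
  simp only [coeff_qSum]
  exact finsum_comp_equiv e (f := fun i => coeff n (f i))

/-- Reindexing along an injection: the terms outside the range have to vanish. -/
theorem qSum_of_injective {φ : κ → ι} (hφ : Function.Injective φ) {f : ι → ℚ⟦X⟧}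
    (h0 : ∀ i, i ∉ Set.range φ → f i = 0) : qSum (fun k => f (φ k)) = qSum f := by
  ext n
  simp only [coeff_qSum]
  rw [← finsum_mem_range (f := fun i => coeff n (f i)) hφ]
  refine finsum_congr fun i => ?_
  by_cases hi : i ∈ Set.range φ
  · simp [hi]
  · simp [hi, h0 i hi]

/-- Fubini for locally finite families. -/
theorem qSum_prod {f : ι × κ → ℚ⟦X⟧} (hf : IsLocallyFinite f) :
    qSum f = qSum fun i => qSum fun k => f (i, k) := by
  ext n
  simp only [coeff_qSum]
  exact finsum_curry (fun p => coeff n (f p)) (hf n)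

theorem qSum_mul {f : ι → ℚ⟦X⟧} {g : κ → ℚ⟦X⟧} (hf : IsLocallyFinite f)
    (hg : IsLocallyFinite g) :
    qSum f * qSum g = qSum fun p : ι × κ => f p.1 * g p.2 := by
  rw [qSum_prod (hf.mul hg), mul_comm, ← qSum_mul_left _ hf]
  congr 1
  funext i
  rw [mul_comm, ← qSum_mul_left _ hg]

theorem qSum_sum {f : ι ⊕ κ → ℚ⟦X⟧} (hf : IsLocallyFinite f) :
    qSum f = qSum (fun i => f (.inl i)) + qSum fun k => f (.inr k) := by
  have hl : qSum (fun i => f (.inl i)) =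
      qSum fun s : ι ⊕ κ => Sum.elim (fun i => f (.inl i)) 0 s := by
    refine qSum_of_injective (f := Sum.elim (fun i => f (.inl i)) 0) Sum.inl_injective ?_
    rintro (i | k) h
    · exact absurd ⟨i, rfl⟩ h
    · rfl
  have hr : qSum (fun k => f (.inr k)) =
      qSum fun s : ι ⊕ κ => Sum.elim 0 (fun k => f (.inr k)) s := by
    refine qSum_of_injective (f := Sum.elim 0 (fun k => f (.inr k))) Sum.inr_injective ?_
    rintro (i | k) h
    · rfl
    · exact absurd ⟨k, rfl⟩ h
  rw [hl, hr, ← qSum_add]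
  · congr 1
    funext s
    rcases s with i | k <;> simp
  · intro n
    refine (hf n).subset ?_
    rintro (i | k) h
    · exact h
    · simp at h
  · intro n
    refine (hf n).subset ?_
    rintro (i | k) h
    · simp at h
    · exact h

/-- A family over the positive integers that vanishes from `n` on has a finite sum. -/
theorem qSum_ite_lt (n : ℕ) (f : ℕ → ℚ⟦X⟧) :
    qSum (fun i : ℕ+ => if (i : ℕ) < n then f i else 0) = ∑ i ∈ Finset.Ico 1 n, f i := by
  classical
  ext m
  rw [coeff_qSum, map_sum]
  have h := finsum_mem_range (f := fun i : ℕ => if i < n then coeff m (f i) else 0)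
    PNat.coe_injective
  have h' : ∀ i : ℕ+, coeff m (if (i : ℕ) < n then f i else 0)
      = if (i : ℕ) < n then coeff m (f i) else 0 := fun i => by split_ifs <;> simp
  rw [finsum_congr h', ← h, ← finsum_mem_coe_finset]
  refine finsum_congr fun i => ?_
  by_cases hi : 0 < i
  · have h1 : i ∈ Set.range ((↑) : ℕ+ → ℕ) := ⟨⟨i, hi⟩, rfl⟩
    have h2 : (i ∈ (↑(Finset.Ico 1 n) : Set ℕ)) ↔ i < n := by
      simp only [Finset.coe_Ico, Set.mem_Ico]
      omega
    rw [finsum_eq_if, if_pos h1, finsum_eq_if]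
    simp only [h2]
  · have h1 : i ∉ Set.range ((↑) : ℕ+ → ℕ) := fun ⟨p, hp⟩ => hi (hp ▸ p.pos)
    have h2 : i ∉ (↑(Finset.Ico 1 n) : Set ℕ) := by
      simp only [Finset.coe_Ico, Set.mem_Ico]
      omega
    rw [finsum_eq_if, if_neg h1, finsum_eq_if, if_neg h2]

end LocallyFinite

/-! ### Sums of monomials -/

section Monomials

variable {ι : Type}

theorem isLocallyFinite_monomial {e : ι → ℕ} (he : ∀ N, {i | e i ≤ N}.Finite) (c : ι → ℚ) :
    IsLocallyFinite fun i => monomial (e i) (c i) := by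
  refine fun N => (he N).subset fun i hi => ?_
  by_contra h
  refine hi ?_
  simp only [Set.mem_ofPred_eq] at h
  dsimp only
  rw [coeff_monomial, if_neg (by omega)]

/-- The sum `∑ c i * q ^ e i` over an index type on which the exponent `e` is bounded on finite
sets only, as a linear function of the coefficients. -/
noncomputable def monomialSum {e : ι → ℕ} (he : ∀ N, {i | e i ≤ N}.Finite) :
    (ι → ℚ) →ₗ[ℚ] ℚ⟦X⟧ where
  toFun c := qSum fun i => monomial (e i) (c i)
  map_add' c d := by
    rw [← qSum_add (isLocallyFinite_monomial he c) (isLocallyFinite_monomial he d)]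
    simp only [Pi.add_apply, map_add]
  map_smul' a c := by
    rw [RingHom.id_apply, ← qSum_smul]
    simp only [Pi.smul_apply, map_smul]

end Monomials

/-! ### Divisor sums, sums over pairs, and the cone `i < j` -/

theorem finite_divisorPairs (N : ℕ) : {p : ℕ+ × ℕ+ | (p.1 * p.2 : ℕ) ≤ N}.Finite := by
  refine (Set.finite_Iic ((N.succPNat, N.succPNat) : ℕ+ × ℕ+)).subset ?_
  rintro ⟨n, m⟩ (h : (n * m : ℕ) ≤ N)
  have hn := n.pos
  have hm := m.pos
  refine Set.mem_Iic.2 ⟨?_, ?_⟩ <;> rw [← PNat.coe_le_coe] <;> simp <;> nlinarith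

theorem finite_diagTriples (N : ℕ) :
    {p : (ℕ+ × ℕ+) × ℕ+ | ((p.1.1 + p.1.2) * p.2 : ℕ) ≤ N}.Finite := by
  refine (Set.finite_Iic (((N.succPNat, N.succPNat), N.succPNat) : (ℕ+ × ℕ+) × ℕ+)).subset ?_
  rintro ⟨⟨i, k⟩, m⟩ (h : ((i + k) * m : ℕ) ≤ N)
  have hi := i.pos
  have hk := k.pos
  have hm := m.pos
  refine Set.mem_Iic.2 ⟨⟨?_, ?_⟩, ?_⟩ <;> rw [← PNat.coe_le_coe] <;> simp <;> nlinarith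

theorem finite_pairQuads (N : ℕ) :
    {p : (ℕ+ × ℕ+) × (ℕ+ × ℕ+) | (p.1.1 * p.2.1 + p.1.2 * p.2.2 : ℕ) ≤ N}.Finite := by
  refine (Set.finite_Iic (((N.succPNat, N.succPNat), (N.succPNat, N.succPNat)) :
    (ℕ+ × ℕ+) × (ℕ+ × ℕ+))).subset ?_
  rintro ⟨⟨i, j⟩, ⟨a, b⟩⟩ (h : (i * a + j * b : ℕ) ≤ N)
  have hi := i.pos
  have hj := j.pos
  have ha := a.pos
  have hb := b.pos
  refine Set.mem_Iic.2 ⟨⟨?_, ?_⟩, ⟨?_, ?_⟩⟩ <;> rw [← PNat.coe_le_coe] <;> simp <;> nlinarith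

theorem finite_coneQuads (N : ℕ) :
    {p : (ℕ+ × ℕ+) × (ℕ+ × ℕ+) | (p.1.1 * p.2.1 + (p.1.1 + p.1.2) * p.2.2 : ℕ) ≤ N}.Finite :=
  (finite_pairQuads N).subset fun p (hp : (_ : ℕ) ≤ N) =>
    le_trans (by rw [add_mul]; omega) hp

/-- `∑_{n, m > 0} c n m * q ^ (n m)`. -/
noncomputable def divisorSum (c : ℚ → ℚ → ℚ) : ℚ⟦X⟧ :=
  monomialSum finite_divisorPairs fun p => c p.1 p.2

/-- `∑_{i, k, m > 0} f i k m * q ^ ((i + k) m)`. -/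
noncomputable def diagonalSum (f : ℚ → ℚ → ℚ → ℚ) : ℚ⟦X⟧ :=
  monomialSum finite_diagTriples fun p => f p.1.1 p.1.2 p.2

/-- `∑_{i, j, a, b > 0} c i j a b * q ^ (i a + j b)`. -/
noncomputable def pairSum (c : ℚ → ℚ → ℚ → ℚ → ℚ) : ℚ⟦X⟧ :=
  monomialSum finite_pairQuads fun p => c p.1.1 p.1.2 p.2.1 p.2.2

/-- `∑_{i, k, a, b > 0} c i k a b * q ^ (i a + (i + k) b)`: the part `j = i + k > i` of a sum over
the solutions of `i a + j b = N`. -/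
noncomputable def coneSum (c : ℚ → ℚ → ℚ → ℚ → ℚ) : ℚ⟦X⟧ :=
  monomialSum finite_coneQuads fun p => c p.1.1 p.1.2 p.2.1 p.2.2

theorem divisorSum_add (c d : ℚ → ℚ → ℚ) :
    divisorSum (fun n m => c n m + d n m) = divisorSum c + divisorSum d :=
  map_add (monomialSum finite_divisorPairs) _ _

theorem divisorSum_sub (c d : ℚ → ℚ → ℚ) :
    divisorSum (fun n m => c n m - d n m) = divisorSum c - divisorSum d :=
  map_sub (monomialSum finite_divisorPairs) _ _

theorem divisorSum_smul (r : ℚ) (c : ℚ → ℚ → ℚ) :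
    divisorSum (fun n m => r * c n m) = r • divisorSum c :=
  map_smul (monomialSum finite_divisorPairs) r fun p : ℕ+ × ℕ+ => c p.1 p.2

theorem diagonalSum_sub (f g : ℚ → ℚ → ℚ → ℚ) :
    diagonalSum (fun i k m => f i k m - g i k m) = diagonalSum f - diagonalSum g :=
  map_sub (monomialSum finite_diagTriples) _ _

theorem pairSum_add (c d : ℚ → ℚ → ℚ → ℚ → ℚ) :
    pairSum (fun i j a b => c i j a b + d i j a b) = pairSum c + pairSum d :=
  map_add (monomialSum finite_pairQuads) _ _

theorem pairSum_sub (c d : ℚ → ℚ → ℚ → ℚ → ℚ) :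
    pairSum (fun i j a b => c i j a b - d i j a b) = pairSum c - pairSum d :=
  map_sub (monomialSum finite_pairQuads) _ _

theorem coneSum_add (c d : ℚ → ℚ → ℚ → ℚ → ℚ) :
    coneSum (fun i j a b => c i j a b + d i j a b) = coneSum c + coneSum d :=
  map_add (monomialSum finite_coneQuads) _ _

theorem coneSum_sub (c d : ℚ → ℚ → ℚ → ℚ → ℚ) :
    coneSum (fun i j a b => c i j a b - d i j a b) = coneSum c - coneSum d :=
  map_sub (monomialSum finite_coneQuads) _ _

theorem coneSum_smul (r : ℚ) (c : ℚ → ℚ → ℚ → ℚ → ℚ) :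
    coneSum (fun i k a b => r * c i k a b) = r • coneSum c :=
  map_smul (monomialSum finite_coneQuads) r
    fun p : (ℕ+ × ℕ+) × (ℕ+ × ℕ+) => c p.1.1 p.1.2 p.2.1 p.2.2

theorem diagonalSum_add (f g : ℚ → ℚ → ℚ → ℚ) :
    diagonalSum (fun i k m => f i k m + g i k m) = diagonalSum f + diagonalSum g :=
  map_add (monomialSum finite_diagTriples) _ _

theorem diagonalSum_smul (r : ℚ) (f : ℚ → ℚ → ℚ → ℚ) :
    diagonalSum (fun i k m => r * f i k m) = r • diagonalSum f :=
  map_smul (monomialSum finite_diagTriples) r fun p : (ℕ+ × ℕ+) × ℕ+ => f p.1.1 p.1.2 p.2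

theorem divisorSum_transpose (c : ℚ → ℚ → ℚ) :
    divisorSum (fun n m => c m n) = divisorSum c := by
  refine Eq.trans ?_ (qSum_comp_equiv (Equiv.prodComm ℕ+ ℕ+) _)
  refine congrArg qSum (funext fun p => ?_)
  simp [mul_comm]

/-- Only the pair `(i, a)` is transposed. -/
theorem pairSum_transpose (c : ℚ → ℚ → ℚ → ℚ → ℚ) :
    pairSum (fun i j a b => c a j i b) = pairSum c := by
  let φ : (ℕ+ × ℕ+) × (ℕ+ × ℕ+) ≃ (ℕ+ × ℕ+) × (ℕ+ × ℕ+) :=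
    ⟨fun p => ((p.2.1, p.1.2), (p.1.1, p.2.2)), fun p => ((p.2.1, p.1.2), (p.1.1, p.2.2)),
      fun _ => rfl, fun _ => rfl⟩
  refine Eq.trans ?_ (qSum_comp_equiv φ _)
  refine congrArg qSum (funext fun p => ?_)
  simp [φ, mul_comm]

/-- Both sides of `i a + (i + k) b = b k + (b + a) i` describe the same exponent: the cone
`j > i` is carried to itself by the transposition of `(i, j)` and `(a, b)` followed by one step of
the Euclidean algorithm. -/
theorem coneSum_euclid (c : ℚ → ℚ → ℚ → ℚ → ℚ) :
    coneSum (fun i k a b => c b a k i) = coneSum c := by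
  let φ : (ℕ+ × ℕ+) × (ℕ+ × ℕ+) ≃ (ℕ+ × ℕ+) × (ℕ+ × ℕ+) :=
    ⟨fun p => ((p.2.2, p.2.1), (p.1.2, p.1.1)), fun p => ((p.2.2, p.2.1), (p.1.2, p.1.1)),
      fun _ => rfl, fun _ => rfl⟩
  refine Eq.trans ?_ (qSum_comp_equiv φ _)
  refine congrArg qSum (funext fun p => ?_)
  have h : (p.1.1 * p.2.1 + (p.1.1 + p.1.2) * p.2.2 : ℕ)
      = p.2.2 * p.1.2 + (p.2.2 + p.2.1) * p.1.1 := by ring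
  simp [φ, h]

theorem divisorSum_mul (u v : ℚ → ℚ → ℚ) :
    divisorSum u * divisorSum v = pairSum fun i j a b => u i a * v j b := by
  refine (qSum_mul (isLocallyFinite_monomial finite_divisorPairs _)
    (isLocallyFinite_monomial finite_divisorPairs _)).trans ?_
  refine Eq.trans ?_ (qSum_comp_equiv (Equiv.prodProdProdComm ℕ+ ℕ+ ℕ+ ℕ+) _)
  refine congrArg qSum (funext fun p => ?_)
  simp [monomial_mul_monomial]

/-- The index set of `pairSum` is the disjoint union of its parts `i < j`, `i > j` and `i = j`.
On the part `i > j` the two summands of the exponent are exchanged, so that it becomes a cone sum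
as well. -/
theorem trichotomy_bijective :
    Function.Bijective (Sum.elim (fun p : (ℕ+ × ℕ+) × (ℕ+ × ℕ+) => ((p.1.1, p.1.1 + p.1.2), p.2))
      (Sum.elim (fun p : (ℕ+ × ℕ+) × (ℕ+ × ℕ+) => ((p.1.1 + p.1.2, p.1.1), p.2.swap))
        fun p : (ℕ+ × ℕ+) × ℕ+ => ((p.2, p.2), p.1))) := by
  constructor
  · rintro (⟨⟨i, k⟩, a, b⟩ | ⟨⟨i, k⟩, a, b⟩ | ⟨⟨a, b⟩, i⟩)
      (⟨⟨i', k'⟩, a', b'⟩ | ⟨⟨i', k'⟩, a', b'⟩ | ⟨⟨a', b'⟩, i'⟩) h <;>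
    simp [← PNat.coe_inj] at h ⊢ <;> (try have := k.pos) <;> (try have := k'.pos) <;> omega
  · rintro ⟨⟨i, j⟩, a, b⟩
    rcases lt_trichotomy i j with h | rfl | h
    · exact ⟨.inl ((i, j - i), a, b), by simp [PNat.add_sub_of_lt h]⟩
    · exact ⟨.inr (.inr ((a, b), i)), rfl⟩
    · exact ⟨.inr (.inl ((j, i - j), b, a)), by simp [PNat.add_sub_of_lt h]⟩

theorem pairSum_eq_coneSum (c : ℚ → ℚ → ℚ → ℚ → ℚ) :
    pairSum c = coneSum (fun i k a b => c i (i + k) a b + c (i + k) i b a) +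
      diagonalSum fun a b i => c i i a b := by
  have hlf := (isLocallyFinite_monomial finite_pairQuads
    fun p => c p.1.1 p.1.2 p.2.1 p.2.2).comp_injective trichotomy_bijective.1
  rw [coneSum_add, add_assoc]
  refine (qSum_comp_equiv (Equiv.ofBijective _ trichotomy_bijective) _).symm.trans ?_
  refine (qSum_sum hlf).trans (congrArg₂ (· + ·) ?_
    ((qSum_sum (hlf.comp_injective Sum.inr_injective)).trans (congrArg₂ (· + ·) ?_ ?_)))
  · refine congrArg qSum (funext fun p => ?_)
    simp
  · refine congrArg qSum (funext fun p => ?_)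
    simp [add_comm]
  · refine congrArg qSum (funext fun p => ?_)
    have h : (p.2 * p.1.1 + p.2 * p.1.2 : ℕ) = (p.1.1 + p.1.2) * p.2 := by ring
    simp [h]

theorem diagonalSum_eq_divisorSum {f : ℚ → ℚ → ℚ → ℚ} {c : ℚ → ℚ → ℚ}
    (h : ∀ n : ℕ, 0 < n → ∀ m : ℚ, ∑ i ∈ Finset.Ico 1 n, f i (n - i) m = c n m) :
    diagonalSum f = divisorSum c := by
  let φ : (ℕ+ × ℕ+) × ℕ+ → (ℕ+ × ℕ+) × ℕ+ := fun p => ((p.1.1 + p.1.2, p.2), p.1.1)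
  have hφ : Function.Injective φ := by
    rintro ⟨⟨i, k⟩, m⟩ ⟨⟨i', k'⟩, m'⟩ h
    simp [φ, ← PNat.coe_inj] at h ⊢
    omega
  let g : (ℕ+ × ℕ+) × ℕ+ → ℚ⟦X⟧ := fun p => if (p.2 : ℕ) < p.1.1 then
    monomial (p.1.1 * p.1.2 : ℕ) (f p.2 ((p.1.1 : ℕ) - (p.2 : ℕ)) p.1.2) else 0
  have hg : IsLocallyFinite g := by
    intro N
    refine (Set.finite_Iic (((N.succPNat, N.succPNat), N.succPNat) : (ℕ+ × ℕ+) × ℕ+)).subset ?_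
    rintro ⟨⟨n, m⟩, i⟩ hi
    simp only [g, Function.mem_support] at hi
    split_ifs at hi with hlt
    · rw [coeff_monomial] at hi
      have hN : N = n * m := by
        by_contra hne
        simp [hne] at hi
      have hn := n.pos
      have hm := m.pos
      refine Set.mem_Iic.2 ⟨⟨?_, ?_⟩, ?_⟩ <;> rw [← PNat.coe_le_coe] <;> simp <;> nlinarith
    · simp at hi
  have h1 : diagonalSum f = qSum g := by
    refine Eq.trans ?_ (qSum_of_injective hφ (f := g) ?_)
    · refine congrArg qSum (funext fun p => ?_)
      have hlt : (p.1.1 : ℕ) < (p.1.1 + p.1.2 : ℕ+) := by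
        have := p.1.2.pos
        rw [PNat.add_coe]
        omega
      simp only [φ, g]
      rw [if_pos hlt]
      simp
    · rintro ⟨⟨n, m⟩, i⟩ hi
      refine if_neg fun hlt => hi ⟨((i, n - i), m), ?_⟩
      have hlt' : i < n := hlt
      simp [φ, PNat.add_sub_of_lt hlt']
  rw [h1, qSum_prod hg]
  refine congrArg qSum (funext fun p => ?_)
  refine (qSum_ite_lt p.1 fun i : ℕ =>
    monomial (p.1 * p.2 : ℕ) (f i ((p.1 : ℕ) - (i : ℕ)) p.2)).trans ?_
  rw [← map_sum, h p.1 p.1.pos]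

/-- A sum over the cone is a sum over pairs of divisors plus a divisor sum whenever its coefficients
are a combination of a coboundary `g i k a b - g b a k i` and of the contribution to the cone of
some `κ + h - hᵗ`, where `hᵗ` is `h` with `(i, a)` transposed. Only the diagonal `i = j` is left
over; it is summed over `i + k = n`, and the result is only needed up to `e n m - e m n`. -/
theorem coneSum_add_diagonalSum (F g h κ : ℚ → ℚ → ℚ → ℚ → ℚ) (f : ℚ → ℚ → ℚ → ℚ)
    (c e : ℚ → ℚ → ℚ)
    (hF : ∀ i k a b, F i k a b = g i k a b - g b a k i +
      ((κ i (i + k) a b + (h i (i + k) a b - h a (i + k) i b)) +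
        (κ (i + k) i b a + (h (i + k) i b a - h b i (i + k) a))))
    (hf : ∀ n : ℕ, 0 < n → ∀ m : ℚ, ∑ i ∈ Finset.Ico 1 n,
      (f i (n - i) m - (κ m m i (n - i) + (h m m i (n - i) - h i m m (n - i))))
        = c n m + (e n m - e m n)) :
    coneSum F + diagonalSum f = pairSum κ + divisorSum c := by
  have h1 := diagonalSum_eq_divisorSum
    (f := fun i k m => f i k m - (κ m m i k + (h m m i k - h i m m k)))
    (c := fun n m => c n m + (e n m - e m n)) hf
  rw [diagonalSum_sub, divisorSum_add, divisorSum_sub, divisorSum_transpose e] at h1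
  have h2 := pairSum_eq_coneSum fun i j a b => κ i j a b + (h i j a b - h a j i b)
  rw [pairSum_add, pairSum_sub, pairSum_transpose h] at h2
  rw [show F = _ from funext fun i => funext fun k => funext fun a => funext fun b => hF i k a b,
    coneSum_add, coneSum_sub, coneSum_euclid g]
  linear_combination h1 - h2

/-! ### Convolutions of divisor sums -/

theorem sum_Ico_pow (n : ℕ) (hn : 0 < n) :
    ∑ i ∈ Finset.Ico 1 n, (i : ℚ) = (n ^ 2 - n) / 2 ∧
    ∑ i ∈ Finset.Ico 1 n, (i : ℚ) ^ 2 = (2 * n ^ 3 - 3 * n ^ 2 + n) / 6 ∧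
    ∑ i ∈ Finset.Ico 1 n, (i : ℚ) ^ 3 = (n ^ 4 - 2 * n ^ 3 + n ^ 2) / 4 ∧
    ∑ i ∈ Finset.Ico 1 n, (i : ℚ) ^ 4 = (6 * n ^ 5 - 15 * n ^ 4 + 10 * n ^ 3 - n) / 30 := by
  induction n, hn using Nat.le_induction with
  | base => norm_num
  | succ n hn ih =>
    obtain ⟨h1, h2, h3, h4⟩ := ih
    simp only [Finset.sum_Ico_succ_top (show 1 ≤ n from hn), h1, h2, h3, h4]
    push_cast
    refine ⟨?_, ?_, ?_, ?_⟩ <;> ring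

theorem sum_Ico_polynomial {n : ℕ} (hn : 0 < n) (c₀ c₁ c₂ c₃ c₄ : ℚ) {p : ℕ → ℚ}
    (hp : ∀ i : ℕ, p i = c₀ + c₁ * i + c₂ * i ^ 2 + c₃ * i ^ 3 + c₄ * i ^ 4) :
    ∑ i ∈ Finset.Ico 1 n, p i = c₀ * (n - 1) + c₁ * ((n ^ 2 - n) / 2) +
      c₂ * ((2 * n ^ 3 - 3 * n ^ 2 + n) / 6) + c₃ * ((n ^ 4 - 2 * n ^ 3 + n ^ 2) / 4) +
      c₄ * ((6 * n ^ 5 - 15 * n ^ 4 + 10 * n ^ 3 - n) / 30) := by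
  obtain ⟨h1, h2, h3, h4⟩ := sum_Ico_pow n hn
  have h0 : ((n - 1 : ℕ) : ℚ) = n - 1 := by
    rw [Nat.cast_sub (show 1 ≤ n from hn), Nat.cast_one]
  simp only [hp, Finset.sum_add_distrib, ← Finset.mul_sum, h1, h2, h3, h4, Finset.sum_const,
    Nat.card_Ico, nsmul_eq_mul, h0]
  ring

/-- `∑_{n, m > 0} n ^ a * m ^ b * q ^ (n m)`, the generating series of `N ^ a * σ_{b - a}(N)`. -/
noncomputable def divisorPowerSum (a b : ℕ) : ℚ⟦X⟧ := divisorSum fun n m => n ^ a * m ^ b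

theorem divisorPowerSum_comm (a b : ℕ) : divisorPowerSum a b = divisorPowerSum b a := by
  unfold divisorPowerSum
  rw [← divisorSum_transpose fun n m => n ^ a * m ^ b]
  simp only [mul_comm]

/-- The form in which `coneSum_add_diagonalSum` evaluates convolutions: nothing is left on the
cone. -/
theorem pairSum_add_divisorSum_eq_zero (g h κ : ℚ → ℚ → ℚ → ℚ → ℚ) (c e : ℚ → ℚ → ℚ)
    (hF : ∀ i k a b, g i k a b - g b a k i +
      ((κ i (i + k) a b + (h i (i + k) a b - h a (i + k) i b)) +
        (κ (i + k) i b a + (h (i + k) i b a - h b i (i + k) a))) = 0)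
    (hf : ∀ n : ℕ, 0 < n → ∀ m : ℚ, ∑ i ∈ Finset.Ico 1 n,
      (κ m m i (n - i) + (h m m i (n - i) - h i m m (n - i))) = -(c n m + (e n m - e m n))) :
    pairSum κ + divisorSum c = 0 := by
  rw [← coneSum_add_diagonalSum (fun _ _ _ _ => 0) g h κ (fun _ _ _ => 0) c e
    (fun i k a b => (hF i k a b).symm)
    fun n hn m => by simp only [zero_sub, Finset.sum_neg_distrib, hf n hn m, neg_neg]]
  exact (add_eq_zero_iff_eq_neg.2 (by
    rw [show coneSum (fun _ _ _ _ => 0) = 0 from map_zero (monomialSum finite_coneQuads),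
      show diagonalSum (fun _ _ _ => 0) = 0 from map_zero (monomialSum finite_diagTriples),
      neg_zero]))

/-- The generating series of `∑ σ(j) σ(N - j) = (5 σ₃(N) + σ(N) - 6 N σ(N)) / 12`. -/
theorem divisorPowerSum_sq : divisorPowerSum 0 1 * divisorPowerSum 0 1 =
    (5 / 12 : ℚ) • divisorPowerSum 0 3 + (1 / 12 : ℚ) • divisorPowerSum 0 1
      - (1 / 2 : ℚ) • divisorPowerSum 1 2 := by
  have key := pairSum_add_divisorSum_eq_zero
    (fun i k a b => -a ^ 2 - a * b - b ^ 2)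
    (fun i j a b => 1 / 2 * j * a + a ^ 2 + 1 / 2 * a * b)
    (fun i j a b => i ^ 1 * a ^ 0 * (j ^ 1 * b ^ 0))
    (fun n m => 1 / 2 * (n ^ 1 * m ^ 2) - 5 / 12 * (n ^ 0 * m ^ 3) - 1 / 12 * (n ^ 0 * m ^ 1))
    (fun n m => -5 / 12 * n ^ 3 + 1 / 2 * n ^ 2 - 1 / 12 * n)
    (fun i k a b => by ring)
    (fun n hn m => (sum_Ico_polynomial hn (-(1 / 2 * n * m + 1 / 2 * m ^ 2)) (1 / 2 * n + m)
      (1 / 2) 0 0 (fun i => by ring)).trans (by ring))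
  rw [← divisorSum_mul] at key
  simp only [divisorSum_sub, divisorSum_smul] at key
  change divisorPowerSum 1 0 * divisorPowerSum 1 0 + ((1 / 2 : ℚ) • divisorPowerSum 1 2
    - (5 / 12 : ℚ) • divisorPowerSum 0 3 - (1 / 12 : ℚ) • divisorPowerSum 0 1) = 0 at key
  rw [divisorPowerSum_comm 1 0] at key
  linear_combination (norm := skip) key
  algebra with ℚ

/-- The generating series of
`∑ σ(j) σ₃(N - j) = (21 σ₅(N) + 10 σ₃(N) - σ(N) - 30 N σ₃(N)) / 240`. -/
theorem divisorPowerSum_mul_cube : divisorPowerSum 0 1 * divisorPowerSum 0 3 =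
    (7 / 80 : ℚ) • divisorPowerSum 0 5 + (1 / 24 : ℚ) • divisorPowerSum 0 3
      - (1 / 240 : ℚ) • divisorPowerSum 0 1 - (1 / 8 : ℚ) • divisorPowerSum 1 4 := by
  have key := pairSum_add_divisorSum_eq_zero
    (fun i k a b => -1 / 4 * a ^ 4 - 1 / 2 * a ^ 3 * b - 3 / 4 * a ^ 2 * b ^ 2
      - 1 / 2 * a * b ^ 3 - 1 / 4 * b ^ 4)
    (fun i j a b => 3 / 8 * j ^ 2 * a ^ 2 + 1 / 2 * j * a ^ 3 + 1 / 4 * a ^ 4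
      + 3 / 8 * a ^ 2 * b ^ 2 + 1 / 2 * a * b ^ 3)
    (fun i j a b => i ^ 1 * a ^ 0 * (j ^ 3 * b ^ 0))
    (fun n m => 1 / 8 * (n ^ 1 * m ^ 4) - 7 / 80 * (n ^ 0 * m ^ 5) - 1 / 24 * (n ^ 0 * m ^ 3)
      + 1 / 240 * (n ^ 0 * m ^ 1))
    (fun n m => -7 / 80 * n ^ 5 + 1 / 8 * n ^ 4 - 1 / 24 * n ^ 3 + 1 / 240 * n)
    (fun i k a b => by ring)
    (fun n hn m => (sum_Ico_polynomial hn
      (-(1 / 2 * n ^ 3 * m + 3 / 8 * n ^ 2 * m ^ 2 + 1 / 8 * m ^ 4))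
      (1 / 2 * n ^ 3 + 3 / 2 * n ^ 2 * m + 3 / 4 * n * m ^ 2) (-(9 / 8 * n ^ 2 + 3 / 2 * n * m))
      (3 / 4 * n + m) (1 / 8) (fun i => by ring)).trans (by ring))
  rw [← divisorSum_mul] at key
  simp only [divisorSum_sub, divisorSum_add, divisorSum_smul] at key
  change divisorPowerSum 1 0 * divisorPowerSum 3 0 + ((1 / 8 : ℚ) • divisorPowerSum 1 4
    - (7 / 80 : ℚ) • divisorPowerSum 0 5 - (1 / 24 : ℚ) • divisorPowerSum 0 3
    + (1 / 240 : ℚ) • divisorPowerSum 0 1) = 0 at key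
  rw [divisorPowerSum_comm 1 0, divisorPowerSum_comm 3 0] at key
  linear_combination (norm := skip) key
  algebra with ℚ

/-- The generating series of
`∑ σ(j) (N - j) σ(N - j) = (5 N σ₃(N) + N σ(N) - 6 N² σ(N)) / 24`. -/
theorem divisorPowerSum_mul_deriv : divisorPowerSum 0 1 * divisorPowerSum 1 2 =
    (5 / 24 : ℚ) • divisorPowerSum 1 4 + (1 / 24 : ℚ) • divisorPowerSum 1 2
      - (1 / 4 : ℚ) • divisorPowerSum 2 3 := by
  have key := pairSum_add_divisorSum_eq_zero
    (fun i k a b => -i * a ^ 2 * b - i * a * b ^ 2 - 1 / 2 * i * b ^ 3 + 1 / 2 * k ^ 3 * b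
      - 1 / 2 * k * a ^ 2 * b - 1 / 2 * k * a * b ^ 2 - 1 / 2 * k * b ^ 3)
    (fun i j a b => 1 / 2 * i * a ^ 3 + 1 / 2 * i * a ^ 2 * b + 1 / 2 * j ^ 2 * a * b
      + 1 / 2 * j * a ^ 2 * b)
    (fun i j a b => i ^ 1 * a ^ 0 * (j ^ 2 * b ^ 1))
    (fun n m => 1 / 4 * (n ^ 2 * m ^ 3) - 5 / 24 * (n ^ 1 * m ^ 4) - 1 / 24 * (n ^ 1 * m ^ 2))
    (fun n m => -5 / 24 * n ^ 4 * m + 1 / 4 * n ^ 3 * m - 1 / 24 * n ^ 2 * m)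
    (fun i k a b => by ring)
    (fun n hn m => (sum_Ico_polynomial hn 0 (-(1 / 2 * m ^ 3)) (n * m) (-(1 / 2 * m)) 0
      (fun i => by ring)).trans (by ring))
  rw [← divisorSum_mul] at key
  simp only [divisorSum_sub, divisorSum_smul] at key
  change divisorPowerSum 1 0 * divisorPowerSum 2 1 + ((1 / 4 : ℚ) • divisorPowerSum 2 3
    - (5 / 24 : ℚ) • divisorPowerSum 1 4 - (1 / 24 : ℚ) • divisorPowerSum 1 2) = 0 at key
  rw [divisorPowerSum_comm 1 0, divisorPowerSum_comm 2 1] at key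
  linear_combination (norm := skip) key
  algebra with ℚ

/-- The cone sum that occurs in `h_{1,1}^{(0)}`. -/
theorem coneSum_add_diagonalSum_weight_zero :
    coneSum (fun i k _ b => i * k * (i + k) * b + k * i * (k + i) * b)
      + diagonalSum (fun i k m => i * k * (i + k) * m) =
    (1 / 3 : ℚ) • divisorPowerSum 1 4 - (1 / 3 : ℚ) • divisorPowerSum 2 3 := by
  have key := coneSum_add_diagonalSum
    (fun i k _ b => i * k * (i + k) * b + k * i * (k + i) * b)
    (fun i k a b => 2 / 3 * i * b ^ 3 - 2 / 3 * k ^ 3 * b + 2 / 3 * k * b ^ 3)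
    (fun i j a b => -2 / 3 * i * a ^ 3) (fun _ _ _ _ => 0)
    (fun i k m => i * k * (i + k) * m)
    (fun n m => 1 / 3 * (n ^ 1 * m ^ 4) - 1 / 3 * (n ^ 2 * m ^ 3))
    (fun n m => 1 / 3 * n ^ 4 * m - 1 / 3 * n ^ 3 * m)
    (fun i k a b => by ring)
    (fun n hn m => (sum_Ico_polynomial hn 0 (n ^ 2 * m - 2 / 3 * m ^ 3) (-n * m) (2 / 3 * m) 0
      (fun i => by ring)).trans (by ring))
  simp only [divisorSum_sub, divisorSum_smul] at key
  rw [key, show pairSum (fun _ _ _ _ => 0) = 0 from map_zero (monomialSum finite_pairQuads),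
    zero_add]
  rfl

/-- The cone sum that occurs in `h_{1,1}^{(2)}`. -/
theorem coneSum_add_diagonalSum_weight_two :
    coneSum (fun i k a b => (k * (i + k) * (b ^ 2 + 2 * a * b) + i * (k + i) * b ^ 2)
        + 1 / 2 * (i * k * b ^ 2 + k * i * b ^ 2))
      + diagonalSum (fun i k m => k * (i + k) * m ^ 2 + 1 / 2 * (i * k * m ^ 2)) =
    (5 / 12 : ℚ) • divisorPowerSum 1 4 - (5 / 12 : ℚ) • divisorPowerSum 2 3 := by
  have key := coneSum_add_diagonalSum
    (fun i k a b => (k * (i + k) * (b ^ 2 + 2 * a * b) + i * (k + i) * b ^ 2)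
        + 1 / 2 * (i * k * b ^ 2 + k * i * b ^ 2))
    (fun i k a b => 2 * i * k * b ^ 2 + 2 * i * a ^ 2 * b + 2 * i * a * b ^ 2 + i * b ^ 3
      - k ^ 3 * b + k ^ 2 * a * b + k ^ 2 * b ^ 2 + k * a ^ 2 * b + k * a * b ^ 2 + k * b ^ 3)
    (fun i j a b => -i * a ^ 3 + j ^ 2 * a * b - j * a ^ 2 * b - j * a * b ^ 2)
    (fun _ _ _ _ => 0)
    (fun i k m => k * (i + k) * m ^ 2 + 1 / 2 * (i * k * m ^ 2))
    (fun n m => 5 / 12 * (n ^ 1 * m ^ 4) - 5 / 12 * (n ^ 2 * m ^ 3))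
    (fun n m => 5 / 12 * n ^ 4 * m + 1 / 12 * n ^ 3 * m ^ 2 - 1 / 2 * n ^ 3 * m
      + 1 / 12 * n ^ 2 * m)
    (fun i k a b => by ring)
    (fun n hn m => (sum_Ico_polynomial hn 0 (n ^ 2 * m + 1 / 2 * n * m ^ 2 - m ^ 3)
      (-n * m - 1 / 2 * m ^ 2) m 0 (fun i => by ring)).trans (by ring))
  simp only [divisorSum_sub, divisorSum_smul] at key
  rw [key, show pairSum (fun _ _ _ _ => 0) = 0 from map_zero (monomialSum finite_pairQuads),
    zero_add]
  rfl

/-- The quasimodular expression of the theorem, as a combination of divisor sums. -/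
theorem okounkov_combination {z₂ z₄ z₆ : ℚ⟦X⟧} (h2 : z₂ = divisorPowerSum 0 1)
    (h4 : z₄ = (1 / 6 : ℚ) • (divisorPowerSum 0 3 - divisorPowerSum 0 1))
    (h6 : z₆ = (1 / 120 : ℚ) • (divisorPowerSum 0 5 - (5 : ℚ) • divisorPowerSum 0 3
      + (4 : ℚ) • divisorPowerSum 0 1)) :
    z₂ ^ 2 + z₄ - (8 / 3 : ℚ) • z₂ ^ 3 + (4 : ℚ) • (z₂ * z₄) + (14 / 3 : ℚ) • z₆ =
      (1 / 3 : ℚ) • divisorPowerSum 1 4 - (1 / 3 : ℚ) • divisorPowerSum 2 3 := by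
  subst h2 h4 h6
  -- The cube is expanded by multiplying the square once more by `divisorPowerSum 0 1`; the
  -- coefficient `-10 / 9 + 2 / 3` of the product `σ * σ₃` that remains is `-4 / 9`.
  have e1 := divisorPowerSum_sq
  have e2 := divisorPowerSum_mul_cube
  have e3 := divisorPowerSum_mul_deriv
  generalize divisorPowerSum 0 1 = s at *
  generalize divisorPowerSum 0 3 = t at *
  generalize divisorPowerSum 1 2 = u at *
  linear_combination (norm := skip)
    e1 - (8 / 3 : ℚ) • (s * e1) - (2 / 9 : ℚ) • e1 - (2 / 3 : ℚ) • e1 - (4 / 9 : ℚ) • e2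
      + (4 / 3 : ℚ) • e3
  algebra with ℚ

/-! ### Expansions of rational functions of `q ^ n` -/

/-- The series `1 / (1 - q ^ n)`. -/
noncomputable def geom (n : ℕ) : ℚ⟦X⟧ := (1 - q ^ n)⁻¹

theorem geom_mul_one_sub {n : ℕ} (hn : 0 < n) : geom n * (1 - q ^ n) = 1 :=
  PowerSeries.inv_mul_cancel _ (by simp [q, hn.ne'])

theorem q_pow_mul_geom {n : ℕ} (hn : 0 < n) : q ^ n * geom n = geom n - 1 := by
  linear_combination -geom_mul_one_sub hn

theorem inv_one_sub (n : ℕ) : (1 - q ^ n)⁻¹ = geom n := rfl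

theorem inv_one_sub_pow (n s : ℕ) : ((1 - q ^ n) ^ s)⁻¹ = geom n ^ s := by
  induction s with
  | zero => simp
  | succ s ih => rw [pow_succ, PowerSeries.mul_inv_rev, ih, pow_succ, mul_comm, geom]

/-- The partial fraction identity that drives all reductions. -/
theorem geom_mul_geom {i k : ℕ} (hi : 0 < i) (hk : 0 < k) :
    geom i * geom k = geom (i + k) * (geom i + geom k - 1) := by
  have h := geom_mul_one_sub (Nat.add_pos_left hi k)
  rw [pow_add] at h
  linear_combination -(geom i * geom k) * h - geom (i + k) *
    (q ^ k * geom k * q_pow_mul_geom hi + (geom i - 1) * q_pow_mul_geom hk)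

/-- The powers `m ^ a` are combinations of the coefficients `(d + m).choose d` of the powers of
`1 / (1 - X)`. -/
theorem mk_pow_eq :
    (mk fun m => (m : ℚ)) = (mk 1 : ℚ⟦X⟧) ^ 2 - mk 1 ∧
    (mk fun m => (m : ℚ) ^ 2) = 2 * (mk 1 : ℚ⟦X⟧) ^ 3 - 3 * mk 1 ^ 2 + mk 1 ∧
    (mk fun m => (m : ℚ) ^ 3) = 6 * (mk 1 : ℚ⟦X⟧) ^ 4 - 12 * mk 1 ^ 3 + 7 * mk 1 ^ 2 - mk 1 ∧
    (mk fun m => (m : ℚ) ^ 4) = 24 * (mk 1 : ℚ⟦X⟧) ^ 5 - 60 * mk 1 ^ 4 + 50 * mk 1 ^ 3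
      - 15 * mk 1 ^ 2 + mk 1 ∧
    (mk fun m => (m : ℚ) ^ 5) = 120 * (mk 1 : ℚ⟦X⟧) ^ 6 - 360 * mk 1 ^ 5 + 390 * mk 1 ^ 4
      - 180 * mk 1 ^ 3 + 31 * mk 1 ^ 2 - mk 1 := by
  have hc : ∀ d m : ℕ, (((m + 1).ascFactorial d : ℕ) : ℚ)
      = (d.factorial : ℚ) * ((d + m).choose d : ℚ) := fun d m => by
    rw [Nat.ascFactorial_eq_factorial_mul_choose, add_comm m d, Nat.cast_mul]
  have hn : ∀ (r : ℕ) (f : ℚ⟦X⟧) (m : ℕ), coeff m ((r : ℚ⟦X⟧) * f) = r * coeff m f :=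
    fun r f m => by
      rw [← map_natCast (C (R := ℚ)), coeff_C_mul]
  -- `simp` does not see the numerals below as casts, so each gets its own instance of `hn`.
  have h2 := hn 2
  have h3 := hn 3
  have h6 := hn 6
  have h7 := hn 7
  have h12 := hn 12
  have h15 := hn 15
  have h24 := hn 24
  have h31 := hn 31
  have h50 := hn 50
  have h60 := hn 60
  have h120 := hn 120
  have h180 := hn 180
  have h360 := hn 360
  have h390 := hn 390
  push_cast at h2 h3 h6 h7 h12 h15 h24 h31 h50 h60 h120 h180 h360 h390
  refine ⟨?_, ?_, ?_, ?_, ?_⟩ <;> ext m <;>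
  · have c1 := hc 1 m
    have c2 := hc 2 m
    have c3 := hc 3 m
    have c4 := hc 4 m
    have c5 := hc 5 m
    simp only [Nat.ascFactorial, Nat.factorial] at c1 c2 c3 c4 c5
    push_cast at c1 c2 c3 c4 c5
    simp only [mk_one_pow_eq_mk_choose_add, map_add, map_sub, coeff_mk, h2, h3, h6, h7, h12, h15,
      h24, h31, h50, h60, h120, h180, h360, h390, Pi.one_apply]
    linarith

theorem expand_mk_one {n : ℕ} (hn : n ≠ 0) : expand n hn (mk 1 : ℚ⟦X⟧) = geom n := by
  have h := congrArg (expand n hn) (mk_one_mul_one_sub_eq_one ℚ)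
  rw [map_mul, map_sub, map_one, expand_X] at h
  have h' := geom_mul_one_sub (Nat.pos_of_ne_zero hn)
  unfold q at h'
  calc expand n hn (mk 1 : ℚ⟦X⟧) = expand n hn (mk 1 : ℚ⟦X⟧) * (geom n * (1 - X ^ n)) := by
        rw [h', mul_one]
    _ = geom n * (expand n hn (mk 1 : ℚ⟦X⟧) * (1 - X ^ n)) := by ring
    _ = geom n := by rw [h, mul_one]

theorem qSum_monomial_eq_expand (n : ℕ+) (u : ℕ → ℚ) :
    qSum (fun m : ℕ+ => monomial (n * m : ℕ) (u m)) = expand n n.ne_zero (mk u) - C (u 0) := by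
  ext N
  rw [coeff_qSum, map_sub, coeff_expand, coeff_C]
  simp only [coeff_monomial]
  by_cases h : ∃ m : ℕ+, N = n * m
  · obtain ⟨m, rfl⟩ := h
    rw [finsum_eq_single _ m]
    · simp
    · intro m' hm'
      refine if_neg fun h => hm' (PNat.eq (Nat.eq_of_mul_eq_mul_left n.pos h.symm))
  · rw [finsum_eq_zero_of_forall_eq_zero fun m => if_neg fun h' => h ⟨m, h'⟩]
    rcases Nat.eq_zero_or_pos N with rfl | hN
    · simp
    · have hd : ¬ (n : ℕ) ∣ N := by
        rintro ⟨m, rfl⟩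
        exact h ⟨⟨m, Nat.pos_of_mul_pos_left hN⟩, rfl⟩
      simp [hd, hN.ne']

theorem qSum_monomial_polynomial (n : ℕ+) (c₀ c₁ c₂ c₃ c₄ c₅ : ℚ) {u : ℕ+ → ℚ}
    (hu : ∀ m : ℕ+, u m = c₀ + c₁ * m + c₂ * m ^ 2 + c₃ * m ^ 3 + c₄ * m ^ 4 + c₅ * m ^ 5) :
    qSum (fun m : ℕ+ => monomial (n * m : ℕ) (u m)) =
      C c₀ * (geom n - 1) + C c₁ * (geom n ^ 2 - geom n)
        + C c₂ * (2 * geom n ^ 3 - 3 * geom n ^ 2 + geom n)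
        + C c₃ * (6 * geom n ^ 4 - 12 * geom n ^ 3 + 7 * geom n ^ 2 - geom n)
        + C c₄ * (24 * geom n ^ 5 - 60 * geom n ^ 4 + 50 * geom n ^ 3 - 15 * geom n ^ 2 + geom n)
        + C c₅ * (120 * geom n ^ 6 - 360 * geom n ^ 5 + 390 * geom n ^ 4 - 180 * geom n ^ 3
          + 31 * geom n ^ 2 - geom n) := by
  obtain ⟨h1, h2, h3, h4, h5⟩ := mk_pow_eq
  have hmk : (mk fun m : ℕ => c₀ + c₁ * m + c₂ * (m : ℚ) ^ 2 + c₃ * (m : ℚ) ^ 3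
      + c₄ * (m : ℚ) ^ 4 + c₅ * (m : ℚ) ^ 5) = C c₀ * mk 1 + C c₁ * (mk fun m => (m : ℚ))
      + C c₂ * (mk fun m => (m : ℚ) ^ 2) + C c₃ * (mk fun m => (m : ℚ) ^ 3)
      + C c₄ * (mk fun m => (m : ℚ) ^ 4) + C c₅ * (mk fun m => (m : ℚ) ^ 5) := by
    ext m
    simp
  simp only [hu]
  rw [qSum_monomial_eq_expand n fun m : ℕ => c₀ + c₁ * m + c₂ * (m : ℚ) ^ 2 + c₃ * (m : ℚ) ^ 3
      + c₄ * (m : ℚ) ^ 4 + c₅ * (m : ℚ) ^ 5, hmk, h1, h2, h3, h4, h5]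
  simp only [map_add, map_sub, map_mul, map_pow, expand_C, expand_mk_one, map_ofNat,
    Nat.cast_zero, map_zero]
  ring

/-! ### The series `Z(2)`, `Z(4)`, `Z(6)` -/

theorem qSum_eq_divisorSum (c : ℚ → ℚ → ℚ) :
    qSum (fun n : ℕ+ => qSum fun m : ℕ+ => monomial (n * m : ℕ) (c n m)) = divisorSum c :=
  (qSum_prod (isLocallyFinite_monomial finite_divisorPairs fun p => c p.1 p.2)).symm

theorem okounkovZ_two : okounkovZ 2 = divisorPowerSum 0 1 := by
  refine Eq.trans (congrArg qSum (funext fun n => ?_)) (qSum_eq_divisorSum _)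
  rw [qSum_monomial_polynomial n 0 1 0 0 0 0 (fun m => by ring), okounkovTerm, okounkovQ,
    inv_one_sub_pow, if_pos even_two]
  have h := q_pow_mul_geom n.pos
  simp only [map_zero, map_one]
  linear_combination geom n * h

theorem okounkovZ_four :
    okounkovZ 4 = (1 / 6 : ℚ) • (divisorPowerSum 0 3 - divisorPowerSum 0 1) := by
  rw [eq_comm, one_div, inv_smul_eq_iff₀ (by norm_num), divisorPowerSum, divisorPowerSum,
    ← divisorSum_sub, okounkovZ, ← qSum_smul, ← qSum_eq_divisorSum]
  refine congrArg qSum (funext fun n => ?_)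
  rw [qSum_monomial_polynomial n 0 (-1) 0 1 0 0 (fun m => by ring), okounkovTerm, okounkovQ,
    inv_one_sub_pow, if_pos (by decide)]
  have h := q_pow_mul_geom n.pos
  simp only [map_zero, map_one, map_neg, smul_eq_C_mul, map_ofNat]
  linear_combination (-6 * geom n ^ 2) * (q ^ (n : ℕ) * geom n + (geom n - 1)) * h

theorem okounkovZ_six :
    okounkovZ 6 = (1 / 120 : ℚ) • (divisorPowerSum 0 5 - (5 : ℚ) • divisorPowerSum 0 3
      + (4 : ℚ) • divisorPowerSum 0 1) := by
  rw [eq_comm, one_div, inv_smul_eq_iff₀ (by norm_num), divisorPowerSum, divisorPowerSum,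
    divisorPowerSum, ← divisorSum_smul, ← divisorSum_smul, ← divisorSum_sub, ← divisorSum_add,
    okounkovZ, ← qSum_smul, ← qSum_eq_divisorSum]
  refine congrArg qSum (funext fun n => ?_)
  rw [qSum_monomial_polynomial n 0 4 0 (-5) 0 1 (fun m => by ring), okounkovTerm, okounkovQ,
    inv_one_sub_pow, if_pos (by decide)]
  have h := q_pow_mul_geom n.pos
  simp only [map_zero, map_one, map_neg, smul_eq_C_mul, map_ofNat]
  linear_combination (-120 * geom n ^ 3) * ((q ^ (n : ℕ) * geom n) ^ 2
    + q ^ (n : ℕ) * geom n * (geom n - 1) + (geom n - 1) ^ 2) * h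

/-! ### The series `h_{1,1}^{(0)}` and `h_{1,1}^{(2)}` -/

theorem finite_weightedPairs (i n : ℕ+) (N : ℕ) :
    {p : ℕ+ × ℕ+ | (i * p.1 + n * p.2 : ℕ) ≤ N}.Finite := by
  refine (Set.finite_Iic ((N.succPNat, N.succPNat) : ℕ+ × ℕ+)).subset ?_
  rintro ⟨a, b⟩ (h : (i * a + n * b : ℕ) ≤ N)
  have hi := i.pos
  have hn := n.pos
  refine Set.mem_Iic.2 ⟨?_, ?_⟩ <;> rw [← PNat.coe_le_coe] <;> simp <;> nlinarith

/-- `∑_{a, b > 0} c a b * q ^ (i a + n b)`, a function of `q ^ i` and `q ^ n`. -/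
noncomputable def weightedSum (i n : ℕ+) (c : ℚ → ℚ → ℚ) : ℚ⟦X⟧ :=
  monomialSum (finite_weightedPairs i n) fun p => c p.1 p.2

theorem weightedSum_mul (i n : ℕ+) (u v : ℚ → ℚ) :
    weightedSum i n (fun a b => u a * v b) = qSum (fun a : ℕ+ => monomial (i * a : ℕ) (u a)) *
      qSum (fun b : ℕ+ => monomial (n * b : ℕ) (v b)) := by
  have hfin : ∀ (i : ℕ+) (N : ℕ), {a : ℕ+ | (i * a : ℕ) ≤ N}.Finite := fun i N => by
    refine (Set.finite_Iic N.succPNat).subset fun a (h : (i * a : ℕ) ≤ N) => ?_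
    have hi := i.pos
    rw [Set.mem_Iic, ← PNat.coe_le_coe]
    simp
    nlinarith
  rw [qSum_mul (isLocallyFinite_monomial (hfin i) _) (isLocallyFinite_monomial (hfin n) _)]
  refine congrArg qSum (funext fun p => ?_)
  simp [monomial_mul_monomial]

theorem weightedSum_polynomial (i n : ℕ+) (α β γ : ℚ) {c : ℚ → ℚ → ℚ}
    (hc : ∀ a b, c a b = α * b + β * b ^ 2 + γ * (a * b)) :
    weightedSum i n c = C α * ((geom i - 1) * (geom n ^ 2 - geom n))
      + C β * ((geom i - 1) * (2 * geom n ^ 3 - 3 * geom n ^ 2 + geom n))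
      + C γ * ((geom i ^ 2 - geom i) * (geom n ^ 2 - geom n)) := by
  have h : weightedSum i n c = weightedSum i n (fun a b => 1 * (α * b + β * b ^ 2))
      + weightedSum i n fun a b => a * (γ * b) := by
    rw [show c = fun a b => 1 * (α * b + β * b ^ 2) + a * (γ * b) from
      funext fun a => funext fun b => by rw [hc]; ring]
    exact map_add (monomialSum (finite_weightedPairs i n)) _ _
  rw [h, weightedSum_mul, weightedSum_mul,
    qSum_monomial_polynomial i 1 0 0 0 0 0 (fun m => by ring),
    qSum_monomial_polynomial i 0 1 0 0 0 0 (fun m => by ring),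
    qSum_monomial_polynomial n 0 α β 0 0 0 (fun m => by ring),
    qSum_monomial_polynomial n 0 γ 0 0 0 0 (fun m => by ring)]
  simp only [map_zero, map_one]
  ring

/-- A double sum over `i` and `k` of functions of `q ^ (i + k)`, of `(q ^ i, q ^ (i + k))` and of
`(q ^ k, q ^ (i + k))` is a cone sum plus a diagonal sum. -/
theorem qSum_eq_coneSum {t : ℕ+ × ℕ+ → ℚ⟦X⟧} (c c' : ℚ → ℚ → ℚ → ℚ → ℚ)
    (f : ℚ → ℚ → ℚ → ℚ)
    (ht : ∀ i k : ℕ+, t (i, k) = weightedSum i (i + k) (c i k) + weightedSum k (i + k) (c' i k)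
      + qSum fun m : ℕ+ => monomial ((i + k : ℕ+) * m : ℕ) (f i k m)) :
    qSum t = coneSum (fun i k a b => c i k a b + c' k i a b) + diagonalSum f := by
  have l1 := isLocallyFinite_monomial finite_coneQuads fun p => c p.1.1 p.1.2 p.2.1 p.2.2
  have l2 := isLocallyFinite_monomial finite_coneQuads fun p => c' p.1.2 p.1.1 p.2.1 p.2.2
  have l3 := isLocallyFinite_monomial finite_diagTriples fun p => f p.1.1 p.1.2 p.2
  have l2' := l2.qSum_snd.comp_injective (Equiv.prodComm ℕ+ ℕ+).injective
  have e1 : coneSum c = _ := qSum_prod l1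
  have e2 : coneSum (fun i k a b => c' k i a b) = _ :=
    (qSum_prod l2).trans (qSum_comp_equiv (Equiv.prodComm ℕ+ ℕ+) _).symm
  have e3 : diagonalSum f = _ := qSum_prod l3
  rw [coneSum_add, e1, e2, e3, ← qSum_add l1.qSum_snd l2',
    ← qSum_add (l1.qSum_snd.add l2') l3.qSum_snd]
  refine congrArg qSum (funext fun p => ?_)
  rw [ht p.1 p.2]
  refine congrArg₂ (· + ·) (congrArg₂ (· + ·) ?_ ?_) ?_
  · refine congrArg qSum (funext fun s => ?_)
    simp
  · refine congrArg qSum (funext fun s => ?_)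
    simp [add_comm]
  · refine congrArg qSum (funext fun s => ?_)
    simp

theorem h11_0_eq : h11_0 =
    coneSum (fun i k _ b => i * k * (i + k) * b + k * i * (k + i) * b)
      + diagonalSum (fun i k m => i * k * (i + k) * m) := by
  refine qSum_eq_coneSum (fun i k _ b => i * k * (i + k) * b) (fun i k _ b => i * k * (i + k) * b)
    (fun i k m => i * k * (i + k) * m) fun i k => ?_
  rw [weightedSum_polynomial i (i + k) (i * k * (i + k)) 0 0 (fun a b => by ring),
    weightedSum_polynomial k (i + k) (i * k * (i + k)) 0 0 (fun a b => by ring),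
    qSum_monomial_polynomial (i + k) 0 (i * k * (i + k)) 0 0 0 0 (fun m => by ring), h0Term]
  simp only [PowerSeries.mul_inv_rev, inv_one_sub, PNat.add_coe]
  have h := geom_mul_geom i.pos k.pos
  have h' := q_pow_mul_geom (Nat.add_pos_left i.pos k)
  simp only [map_zero, map_mul, map_add, map_natCast]
  push_cast
  linear_combination (i * k * (i + k) : ℚ⟦X⟧) * (geom i * geom k * h' + (geom (i + k) - 1) * h)

theorem h2TermA_eq : qSum h2TermA =
    coneSum (fun i k a b => k * (i + k) * (b ^ 2 + 2 * a * b) + i * (k + i) * b ^ 2)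
      + diagonalSum (fun i k m => k * (i + k) * m ^ 2) := by
  refine qSum_eq_coneSum (fun i k a b => k * (i + k) * (b ^ 2 + 2 * a * b))
    (fun i k _ b => k * (i + k) * b ^ 2) (fun i k m => k * (i + k) * m ^ 2) fun i k => ?_
  rw [weightedSum_polynomial i (i + k) 0 (k * (i + k)) (2 * (k * (i + k))) (fun a b => by ring),
    weightedSum_polynomial k (i + k) 0 (k * (i + k)) 0 (fun a b => by ring),
    qSum_monomial_polynomial (i + k) 0 0 (k * (i + k)) 0 0 0 (fun m => by ring), h2TermA]
  simp only [PowerSeries.mul_inv_rev, inv_one_sub_pow, inv_one_sub, PNat.add_coe]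
  have h := geom_mul_geom i.pos k.pos
  have h' := q_pow_mul_geom (Nat.add_pos_left i.pos k)
  have h'' := q_pow_mul_geom i.pos
  rw [show (2 * i + k : ℕ) = (i + k) + i by ring, pow_add q (i + k)]
  simp only [map_zero, map_mul, map_add, map_natCast, map_ofNat]
  push_cast
  linear_combination (k * (i + k) : ℚ⟦X⟧) * ((geom i ^ 2 * geom k * (1 + q ^ (i : ℕ))) * h'
    + (geom (i + k) - 1) * geom i * geom k * h''
    + (geom (i + k) - 1) * (2 * geom i - 1 + 2 * geom (i + k)) * h)

theorem h2TermB_eq : qSum h2TermB =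
    coneSum (fun i k _ b => i * k * b ^ 2 + k * i * b ^ 2)
      + diagonalSum (fun i k m => i * k * m ^ 2) := by
  refine qSum_eq_coneSum (fun i k _ b => i * k * b ^ 2) (fun i k _ b => i * k * b ^ 2)
    (fun i k m => i * k * m ^ 2) fun i k => ?_
  rw [weightedSum_polynomial i (i + k) 0 (i * k) 0 (fun a b => by ring),
    weightedSum_polynomial k (i + k) 0 (i * k) 0 (fun a b => by ring),
    qSum_monomial_polynomial (i + k) 0 0 (i * k) 0 0 0 (fun m => by ring), h2TermB]
  simp only [PowerSeries.mul_inv_rev, inv_one_sub_pow, inv_one_sub, PNat.add_coe]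
  have h := geom_mul_geom i.pos k.pos
  have h' := q_pow_mul_geom (Nat.add_pos_left i.pos k)
  rw [show (2 * i + 2 * k : ℕ) = (i + k) + (i + k) by ring, pow_add q (i + k)]
  simp only [map_zero, map_mul, map_natCast]
  push_cast
  linear_combination (i * k : ℚ⟦X⟧) * (geom i * geom k *
    (geom (i + k) + (q ^ (i + k : ℕ) * geom (i + k) + geom (i + k) - 1)) * h'
    + (geom (i + k) - 1) * (2 * geom (i + k) - 1) * h)

theorem h11_2_eq : h11_2 =
    -((5 / 12 : ℚ) • divisorPowerSum 1 4 - (5 / 12 : ℚ) • divisorPowerSum 2 3) := by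
  rw [← coneSum_add_diagonalSum_weight_two, coneSum_add _ fun i k a b =>
    1 / 2 * (i * k * b ^ 2 + k * i * b ^ 2), diagonalSum_add _ fun i k m => 1 / 2 * (i * k * m ^ 2),
    coneSum_smul, diagonalSum_smul, h11_2, h2TermA_eq, h2TermB_eq, smul_add]
  abel

/-! ### The series `h_{1,1}^{(4)}` -/

/-- The factor `n q ^ n (1 + q ^ n) / (1 - q ^ n)` common to the three sums in `h_{1,1}^{(4)}`. -/
noncomputable def quarticWeight (n : ℕ+) : ℚ⟦X⟧ :=
  (n : ℕ) * q ^ (n : ℕ) * (1 + q ^ (n : ℕ)) * geom n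

/-- The summand `1 / ((1 - q ^ i) (1 - q ^ (n - i)))` for `i < n`, extended by zero. -/
noncomputable def splitTerm (n i : ℕ+) : ℚ⟦X⟧ :=
  if (i : ℕ) < n then geom i * geom ((n : ℕ) - i) else 0

/-- The summand `q ^ k / ((1 - q ^ k) (1 - q ^ (n + k)))`. -/
noncomputable def shiftTerm (n k : ℕ+) : ℚ⟦X⟧ := q ^ (k : ℕ) * geom k * geom (n + k)

theorem splitTerm_add (i j : ℕ+) : splitTerm (i + j) i = geom i * geom j := by
  have hj := j.pos
  rw [splitTerm, PNat.add_coe, if_pos (by omega), Nat.add_sub_cancel_left]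

theorem quarticWeight_mul_isLocallyFinite (a : ℕ+ → ℚ⟦X⟧) :
    IsLocallyFinite fun n => quarticWeight n * a n := by
  refine .of_dvd (fun n => (n : ℕ)) (fun n => ?_) fun N => ?_
  · exact (((dvd_mul_left _ _).mul_right _).mul_right _).mul_right _
  · refine (Set.finite_Iic N.succPNat).subset fun i (hi : (i : ℕ) ≤ N) => ?_
    rw [Set.mem_Iic, ← PNat.coe_le_coe]
    simp
    omega

theorem splitTerm_isLocallyFinite (n : ℕ+) : IsLocallyFinite (splitTerm n) := by
  refine fun N => (Set.finite_Iic n).subset fun i hi => ?_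
  by_contra h
  refine hi ?_
  have h' : ¬ (i : ℕ) < n := fun hlt => h (le_of_lt hlt)
  simp [splitTerm, h']

theorem q_pow_mul_isLocallyFinite (a : ℕ+ → ℚ⟦X⟧) :
    IsLocallyFinite fun k : ℕ+ => q ^ (k : ℕ) * a k := by
  refine .of_dvd (fun k => (k : ℕ)) (fun k => dvd_mul_right _ _) fun N => ?_
  refine (Set.finite_Iic N.succPNat).subset fun i (hi : (i : ℕ) ≤ N) => ?_
  rw [Set.mem_Iic, ← PNat.coe_le_coe]
  simp
  omega

theorem shiftTerm_isLocallyFinite (n : ℕ+) : IsLocallyFinite (shiftTerm n) := by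
  have h := q_pow_mul_isLocallyFinite fun k => geom k * geom (n + k)
  simp only [← mul_assoc] at h
  exact h

/-- The sum of a family indexed by `n` and by two further indices, when these separate. -/
theorem qSum_quarticWeight_mul {f g : ℕ+ → ℕ+ → ℚ⟦X⟧} (hf : ∀ n, IsLocallyFinite (f n))
    (hg : ∀ n, IsLocallyFinite (g n))
    (h : IsLocallyFinite fun p : ℕ+ × (ℕ+ × ℕ+) =>
      quarticWeight p.1 * (f p.1 p.2.1 * g p.1 p.2.2)) :
    qSum (fun p : ℕ+ × (ℕ+ × ℕ+) => quarticWeight p.1 * (f p.1 p.2.1 * g p.1 p.2.2)) =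
      qSum fun n => quarticWeight n * (qSum (f n) * qSum (g n)) := by
  rw [qSum_prod h]
  refine congrArg qSum (funext fun n => ?_)
  rw [qSum_mul (hf n) (hg n), ← qSum_mul_left _ ((hf n).mul (hg n))]

theorem finite_triples_div (d N : ℕ) (hd : 0 < d) :
    {p : ℕ+ × (ℕ+ × ℕ+) | ((p.1 + p.2.1 + p.2.2 : ℕ) / d) ≤ N}.Finite := by
  refine (finite_triples (d * (N + 1))).subset fun p (hp : (p.1 + p.2.1 + p.2.2 : ℕ) / d ≤ N) => ?_
  exact (Nat.lt_mul_of_div_lt (Nat.lt_succ_of_le hp) hd).le.trans (by rw [mul_comm])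

theorem qSum_h4TermA :
    qSum h4TermA = qSum fun n => quarticWeight n * (qSum (splitTerm n) * qSum (splitTerm n)) := by
  let φ : QuadIndex → ℕ+ × (ℕ+ × ℕ+) := fun p => (p.1.1 + p.1.2.1, (p.1.1, p.1.2.2.1))
  have hφ : Function.Injective φ := by
    rintro ⟨⟨i, j, k, l⟩, hp⟩ ⟨⟨i', j', k', l'⟩, hp'⟩ h
    refine Subtype.ext ?_
    simp only [φ, Prod.mk.injEq, ← PNat.coe_inj, PNat.add_coe] at h hp hp' ⊢
    omega
  rw [← qSum_quarticWeight_mul splitTerm_isLocallyFinite splitTerm_isLocallyFinite]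
  · refine Eq.trans ?_ (qSum_of_injective hφ ?_)
    · refine congrArg qSum (funext ?_)
      rintro ⟨⟨i, j, k, l⟩, hp⟩
      change _ = quarticWeight (i + j) * (splitTerm (i + j) i * splitTerm (i + j) k)
      have h : splitTerm (i + j) k = geom k * geom l := by
        rw [show i + j = k + l from hp, splitTerm_add]
      rw [h, splitTerm_add]
      simp only [quarticWeight, h4TermA, PNat.add_coe, PowerSeries.mul_inv_rev, inv_one_sub]
      ring
    · rintro ⟨n, i, k⟩ hi
      by_cases h1 : i < n
      · by_cases h2 : k < n
        · refine absurd ⟨⟨(i, n - i, k, n - k), ?_⟩, ?_⟩ hi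
          · simp [PNat.add_sub_of_lt h1, PNat.add_sub_of_lt h2]
          · simp [φ, PNat.add_sub_of_lt h1]
        · have h2' : ¬ (k : ℕ) < n := h2
          simp [splitTerm, h2']
      · have h1' : ¬ (i : ℕ) < n := h1
        simp [splitTerm, h1']
  · -- Here `n ≥ (n + i + k) / 3` because `i, k < n` for nonzero terms.
    refine .of_dvd (fun p => (p.1 + p.2.1 + p.2.2 : ℕ) / 3) ?_
      fun N => finite_triples_div 3 N (by norm_num)
    rintro ⟨n, i, k⟩
    simp only [splitTerm]
    split_ifs with h1 h2
    · refine ((((dvd_mul_of_dvd_right (pow_dvd_pow _ ?_) _).mul_right _).mul_right _).mul_right _)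
      omega
    all_goals simp

theorem qSum_h4TermB :
    qSum h4TermB = qSum fun n => quarticWeight n * (qSum (splitTerm n) * qSum (shiftTerm n)) := by
  let φ : ℕ+ × ℕ+ × ℕ+ → ℕ+ × (ℕ+ × ℕ+) := fun p => (p.1 + p.2.1, (p.1, p.2.2))
  have hφ : Function.Injective φ := by
    rintro ⟨i, j, k⟩ ⟨i', j', k'⟩ h
    simp only [φ, Prod.mk.injEq, ← PNat.coe_inj, PNat.add_coe] at h ⊢
    omega
  rw [← qSum_quarticWeight_mul splitTerm_isLocallyFinite shiftTerm_isLocallyFinite]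
  · refine Eq.trans ?_ (qSum_of_injective hφ ?_)
    · refine congrArg qSum (funext ?_)
      rintro ⟨i, j, k⟩
      change _ = quarticWeight (i + j) * (splitTerm (i + j) i * shiftTerm (i + j) k)
      rw [splitTerm_add]
      simp only [shiftTerm, quarticWeight, h4TermB, PNat.add_coe, PowerSeries.mul_inv_rev,
        inv_one_sub]
      rw [pow_add q (i + j : ℕ)]
      ring
    · rintro ⟨n, i, k⟩ hi
      by_cases h1 : i < n
      · exact absurd ⟨(i, n - i, k), by simp [φ, PNat.add_sub_of_lt h1]⟩ hi
      · have h1' : ¬ (i : ℕ) < n := h1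
        simp [splitTerm, h1']
  · -- Here `n + k ≥ (n + i + k) / 2` because `i < n` for nonzero terms.
    refine .of_dvd (fun p => (p.1 + p.2.1 + p.2.2 : ℕ) / 2) ?_
      fun N => finite_triples_div 2 N (by norm_num)
    rintro ⟨n, i, k⟩
    simp only [splitTerm]
    split_ifs with h1
    · refine (pow_dvd_pow q (show (n + i + k : ℕ) / 2 ≤ n + k by omega)).trans ?_
      rw [pow_add]
      refine mul_dvd_mul ?_ ?_
      · exact ((dvd_mul_left _ _).mul_right _).mul_right _
      · exact ((dvd_mul_right _ _).mul_right _).mul_left _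
    · simp

theorem qSum_h4TermC :
    qSum h4TermC = qSum fun n => quarticWeight n * (qSum (shiftTerm n) * qSum (shiftTerm n)) := by
  let φ : ℕ+ × ℕ+ × ℕ+ ≃ ℕ+ × (ℕ+ × ℕ+) :=
    ⟨fun p => (p.2.2, (p.1, p.2.1)), fun p => (p.2.1, p.2.2, p.1), fun _ => rfl, fun _ => rfl⟩
  have key : h4TermC = fun p => quarticWeight (φ p).1 *
      (shiftTerm (φ p).1 (φ p).2.1 * shiftTerm (φ p).1 (φ p).2.2) := by
    funext ⟨i, j, k⟩
    simp only [φ, Equiv.coe_fn_mk, shiftTerm, quarticWeight, h4TermC,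
      PowerSeries.mul_inv_rev, inv_one_sub, add_comm (k : ℕ)]
    rw [pow_add, pow_add]
    ring
  rw [← qSum_quarticWeight_mul shiftTerm_isLocallyFinite shiftTerm_isLocallyFinite, key]
  · exact qSum_comp_equiv φ fun p => quarticWeight p.1 *
      (shiftTerm p.1 p.2.1 * shiftTerm p.1 p.2.2)
  · have h := h4TermC_isLocallyFinite.comp_injective φ.symm.injective
    simp only [key, Equiv.apply_symm_apply] at h
    exact h

theorem qSum_splitTerm (n : ℕ+) : qSum (splitTerm n) =
    geom n * ((n : ℕ) - 1 + 2 * ∑ i ∈ Finset.Ico 1 (n : ℕ), (geom i - 1)) := by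
  have h1 := qSum_ite_lt n fun i => geom i * geom ((n : ℕ) - i)
  have h2 : ∑ i ∈ Finset.Ico 1 (n : ℕ), (geom ((n : ℕ) - i) - 1)
      = ∑ i ∈ Finset.Ico 1 (n : ℕ), (geom i - 1) := by
    have h := Finset.sum_Ico_reflect (fun i => geom i - 1) 1 (Nat.le_succ n)
    rwa [Nat.add_sub_cancel_left, Nat.add_sub_cancel] at h
  have h3 : ((n : ℕ) : ℚ⟦X⟧) - 1 = ∑ i ∈ Finset.Ico 1 (n : ℕ), 1 := by
    rw [Finset.sum_const, Nat.card_Ico, nsmul_eq_mul, mul_one, Nat.cast_sub n.pos, Nat.cast_one]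
  refine h1.trans ?_
  rw [two_mul, h3]
  conv_rhs =>
    enter [2, 2, 2]
    rw [← h2]
  rw [← Finset.sum_add_distrib, ← Finset.sum_add_distrib, Finset.mul_sum]
  refine Finset.sum_congr rfl fun i hi => ?_
  obtain ⟨hi1, hi2⟩ := Finset.mem_Ico.1 hi
  have h := geom_mul_geom (show 0 < i from hi1) (Nat.sub_pos_of_lt hi2)
  rw [Nat.add_sub_cancel' hi2.le] at h
  linear_combination h

/-- The sum telescopes, since `q ^ k / ((1 - q ^ k) (1 - q ^ (n + k)))` is `1 / (1 - q ^ n)` times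
the difference of the values of `q ^ k / (1 - q ^ k)` at `k` and `n + k`. -/
theorem qSum_shiftTerm (n : ℕ+) : qSum (shiftTerm n) =
    geom n * (∑ i ∈ Finset.Ico 1 (n : ℕ), (geom i - 1) + (geom n - 1)) := by
  have hP : IsLocallyFinite fun k : ℕ+ => geom k - 1 := by
    have h := q_pow_mul_isLocallyFinite fun k => geom k
    simp only [q_pow_mul_geom (PNat.pos _)] at h
    exact h
  have hP' := hP.comp_injective (add_right_injective n)
  have hlt : IsLocallyFinite fun k : ℕ+ => if (k : ℕ) < n + 1 then geom k - 1 else 0 := by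
    intro N
    refine (hP N).subset fun k hk h0 => hk ?_
    dsimp only at h0 ⊢
    split_ifs
    · exact h0
    · simp
  have hge : IsLocallyFinite fun k : ℕ+ => if (k : ℕ) < n + 1 then 0 else geom k - 1 := by
    intro N
    refine (hP N).subset fun k hk h0 => hk ?_
    dsimp only at h0 ⊢
    split_ifs
    · simp
    · exact h0
  have h1 : qSum (fun k : ℕ+ => geom k - 1)
      = ∑ i ∈ Finset.Ico 1 ((n : ℕ) + 1), (geom i - 1)
        + qSum fun k : ℕ+ => geom (n + k : ℕ+) - 1 := by
    rw [← qSum_ite_lt, show qSum (fun k : ℕ+ => geom (n + k : ℕ+) - 1)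
      = qSum fun k : ℕ+ => if (k : ℕ) < n + 1 then 0 else geom k - 1 from ?_, ← qSum_add hlt hge]
    · refine congrArg qSum (funext fun k => ?_)
      split_ifs <;> simp
    · refine Eq.trans ?_ (qSum_of_injective (add_right_injective n) ?_)
      · refine congrArg qSum (funext fun k => ?_)
        have hk := k.pos
        rw [if_neg (by rw [PNat.add_coe]; omega)]
      · intro k hk
        refine if_pos ?_
        by_contra h
        have h' : n < k := by
          rw [← PNat.coe_lt_coe]
          omega
        exact hk ⟨k - n, PNat.add_sub_of_lt h'⟩
  have h2 : geom n * qSum (fun k : ℕ+ => geom k - 1)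
      = qSum (shiftTerm n) + geom n * qSum fun k : ℕ+ => geom (n + k : ℕ+) - 1 := by
    rw [← qSum_mul_left _ hP, ← qSum_mul_left _ hP', ← qSum_add (shiftTerm_isLocallyFinite n)
      (hP'.mul_left _)]
    refine congrArg qSum (funext fun k => ?_)
    have h := geom_mul_geom n.pos k.pos
    have h' := q_pow_mul_geom k.pos
    rw [shiftTerm, PNat.add_coe]
    linear_combination h - geom (n + k) * h'
  rw [Finset.sum_Ico_succ_top (show 1 ≤ (n : ℕ) from n.pos)] at h1
  linear_combination geom n * h1 - h2

/-- The three sums combine to a perfect square, in which the partial sums of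
`q ^ i / (1 - q ^ i)` cancel. -/
theorem four_smul_h11_4 : (4 : ℚ) • h11_4 =
    qSum fun n => quarticWeight n * (geom n * ((n : ℕ) + 1 - 2 * geom n)) ^ 2 := by
  have h : (4 : ℚ) • h11_4
      = qSum h4TermA + ((-4 : ℚ) • qSum h4TermB + (4 : ℚ) • qSum h4TermC) := by
    rw [h11_4]
    module
  have lf := quarticWeight_mul_isLocallyFinite
  rw [h, qSum_h4TermA, qSum_h4TermB, qSum_h4TermC, ← qSum_smul, ← qSum_smul]
  simp only [← mul_smul_comm]
  rw [← qSum_add (lf _) (lf _), ← qSum_add (lf _) ((lf _).add (lf _))]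
  refine congrArg qSum (funext fun n => ?_)
  simp only [qSum_splitTerm, qSum_shiftTerm, smul_eq_C_mul, map_neg, map_ofNat]
  ring

theorem h11_4_eq :
    h11_4 = (1 / 12 : ℚ) • (divisorPowerSum 1 4 - divisorPowerSum 2 3) := by
  have h : (3 : ℚ) • (4 : ℚ) • h11_4 = divisorSum fun n m =>
      3 * (n ^ 3 * m ^ 2) - 4 * (n ^ 2 * m ^ 3) - 2 * (n ^ 2 * m ^ 1) + 1 * (n ^ 1 * m ^ 4)
        + 2 * (n ^ 1 * m ^ 2) := by
    rw [four_smul_h11_4, ← qSum_smul, ← qSum_eq_divisorSum]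
    refine congrArg qSum (funext fun n => ?_)
    rw [qSum_monomial_polynomial n 0 (-2 * n ^ 2) (3 * n ^ 3 + 2 * n) (-4 * n ^ 2) n 0
      (fun m => by ring), quarticWeight]
    have h := q_pow_mul_geom n.pos
    simp only [map_zero, map_mul, map_add, map_neg, map_pow, map_natCast, map_ofNat, smul_eq_C_mul]
    linear_combination (3 * (n : ℕ) * geom n * (((n : ℕ) : ℚ⟦X⟧) + 1 - 2 * geom n) ^ 2 *
      (geom n + q ^ (n : ℕ) * geom n + geom n - 1)) * h
  simp only [divisorSum_sub, divisorSum_add, divisorSum_smul] at h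
  change (3 : ℚ) • (4 : ℚ) • h11_4 = (3 : ℚ) • divisorPowerSum 3 2 - (4 : ℚ) • divisorPowerSum 2 3
    - (2 : ℚ) • divisorPowerSum 2 1 + (1 : ℚ) • divisorPowerSum 1 4
    + (2 : ℚ) • divisorPowerSum 1 2 at h
  rw [divisorPowerSum_comm 3 2, divisorPowerSum_comm 2 1] at h
  linear_combination (norm := module) (1 / 12 : ℚ) • h

end QSeries

open QSeries
theorem propositionh11024 :
    h11_0 =
        okounkovZ 2 ^ 2 + okounkovZ 4 - (8 / 3 : ℚ) • okounkovZ 2 ^ 3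
          + (4 : ℚ) • (okounkovZ 2 * okounkovZ 4) + (14 / 3 : ℚ) • okounkovZ 6 ∧
    h11_2 =
        -((5 / 4 : ℚ) • okounkovZ 2 ^ 2 + (5 / 4 : ℚ) • okounkovZ 4
          - (10 / 3 : ℚ) • okounkovZ 2 ^ 3
          + (5 : ℚ) • (okounkovZ 2 * okounkovZ 4) + (35 / 6 : ℚ) • okounkovZ 6) ∧
    h11_4 =
        (1 / 4 : ℚ) • okounkovZ 2 ^ 2 + (1 / 4 : ℚ) • okounkovZ 4
          - (2 / 3 : ℚ) • okounkovZ 2 ^ 3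
          + okounkovZ 2 * okounkovZ 4 + (7 / 6 : ℚ) • okounkovZ 6 := by
  have key := okounkov_combination okounkovZ_two okounkovZ_four okounkovZ_six
  have h0 := h11_0_eq.trans coneSum_add_diagonalSum_weight_zero
  have h2 := h11_2_eq
  have h4 := h11_4_eq
  refine ⟨h0.trans key.symm, h2.trans ?_, h4.trans ?_⟩
  · linear_combination (norm := module) (5 / 4 : ℚ) • key
  · linear_combination (norm := module) -(1 / 4 : ℚ) • key
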